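/- **Theorem.** Let $\Omega\subset\mathbb R^d$ ($d\ge1$) be a bounded, open, connected $C^1$ domain, and let $\Gamma_D,\Gamma_N$ be disjoint relatively open subsets of $\Gamma=\partial\Omega$ with $\Gamma=\overline{\Gamma_D}\cup\overline{\Gamma_N}$ and $|\overline{\Gamma_D}\cap\overline{\Gamma_N}|=0$ (surface measure $ds$). Let $\alpha,\beta>1$, $\gamma=\alpha\beta$, and write $\tau'=\tau/(\tau-1)$. Assume the following. * $G\in C^1(\mathbb R)$ is convex, non-decreasing and coercive ($G(z)\to\infty$ as $z\to+\infty$), and for some $C>0$ and all sufficiently large $z$: $|z|^\alpha/C-C\le G(z)\le C(|z|^\alpha+1)$, $|G'(z)|\le C(|z|^{\alpha-1}+1)$, $G'(z)z\ge -C$. The coupling $g:[0,\infty)\to\mathbb R$ is the pseudo-inverse of $G'$, i.e. $g(\mu)=\max\{z: G'(z)=\mu\}$ for every $\mu\ge0$ (in particular these maxima exist). * $H\in C^2(\overline\Omega\times\mathbb R^d)$ is bounded below, $p\mapsto H(x,p)$ is strictly convex for every $x\in\Omega$, and for some $C>0$ and all $(x,p)\in\Omega\times\mathbb R^d$: $|p|^\beta/C-C\le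 H\le C(|p|^\beta+1)$, $|D_xH|\le C(|p|^\beta+1)$, $|D_pH|\le C(|p|^{\beta-1}+1)$, $-H+D_pH\cdot p\ge|p|^\beta/C-C$. * $j\in L^{\beta'}(\Gamma_N)$, $j\ge0$, and $\psi\in W^{1,\gamma}(\Omega)$. For a divergence-free field $\Phi\in L^{\gamma'}(\Omega)^d$ the normal trace $\Phi\cdot\nu$ is the functional $\langle\Phi\cdot\nu,v\rangle=\int_\Omega\Phi\cdot Dv\,dx$ of the trace of $v\in W^{1,\gamma}(\Omega)$. It equals $j$ on $\Gamma_N$ if $\langle\Phi\cdot\nu,v\rangle=\int_{\Gamma_N}jv\,ds$ for all $v\in W^{1,\gamma}(\Omega)$ with $v=0$ a.e. on $\Gamma_D$. Then $\langle\Phi\cdot\nu,v\rangle_{\Gamma_D}:=\langle\Phi\cdot\nu,v\rangle-\int_{\Gamma_N}jv\,ds$ depends only on $v|_{\Gamma_D}$ and is the normal trace on $\Gamma_D$. There, $\Phi\cdot\nu\le0$ means $\langle\Phi\cdot\nu,v\rangle_{\Gamma_D}\le0$ for all $v\in W^{1,\gamma}(\Omega)$ with $v\ge0$ a.e. on $\Gamma_D$,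 and, for $w\in W^{1,\gamma}(\Omega)$, $w\,\Phi\cdot\nu=0$ means $\langle\Phi\cdot\nu,\varphi w\rangle_{\Gamma_D}=0$ for all $\varphi\in C^\infty(\overline\Omega)$. A weak solution is a pair $(m,u)\in L^{\alpha'}(\Omega)\times W^{1,\gamma}(\Omega)$ with $m\ge0$, $mD_pH(x,Du)\in L^1(\Omega)^d$, $H(x,Du)=g(m)$ a.e. in $\{m>0\}$, $H(x,Du)\le g(m)$ a.e. in $\Omega$, $-\operatorname{div}(mD_pH(x,Du))=0$ in the sense of distributions, and, in the sense of traces and normal traces, $$mD_pH(x,Du)\cdot\nu=j\ \text{ on }\Gamma_N;\qquad mD_pH(x,Du)\cdot\nu\le0,\quad u\le\psi,\quad(\psi-u)\,mD_pH(x,Du)\cdot\nu=0\ \text{ on }\Gamma_D.$$ Let $(m,u)$ and $(\eta,\xi)$ be two weak solutions. Then: 1. $(\psi-u)\,\eta D_pH(x,D\xi)\cdot\nu=(\psi-\xi)\,mD_pH(x,Du)\cdot\nu=0$ on $\Gamma_D$ in the sense of normal traces. Moreover, if the normal trace of $\eta D_pH(x,D\xi)$ on $\Gamma_D$ is given by a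 locally integrable function $h$ (tested against smooth functions whose support meets $\Gamma$ only inside $\Gamma_D$), then $(\psi-u)h=0$ at almost every point of $\Gamma_D$; likewise for $mD_pH(x,Du)$ and $\psi-\xi$. 2. $\eta=m$ a.e. in $\Omega$. 3. $Du=D\xi$ a.e. in $\{x\in\Omega: m(x)>0\}$. -/

import Mathlib

open MeasureTheory Set Filter Topology
open scoped ContDiff RealInnerProductSpace

noncomputable section

namespace MixedMFG

/-- The Euclidean space `ℝ^d`. -/
abbrev Eu (d : ℕ) : Type := EuclideanSpace ℝ (Fin d)

variable {d : ℕ}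

/-! ### The domain and its boundary -/

/-- `Ω` has a `C¹` boundary: near each boundary point, `Ω` is the strict subgraph, in some unit
direction `e`, of a `C¹` function defined on the hyperplane orthogonal to `e`. -/
def HasC1Boundary (Ω : Set (Eu d)) : Prop :=
  ∀ x₀ ∈ frontier Ω, ∃ e : Eu d, ‖e‖ = 1 ∧ ∃ h : ((ℝ ∙ e)ᗮ : Submodule ℝ (Eu d)) → ℝ,
    ContDiff ℝ 1 h ∧ ∃ r > 0, ∀ y ∈ Metric.ball x₀ r,
      (y ∈ Ω ↔ ⟪e, y⟫ < h ((ℝ ∙ e)ᗮ.orthogonalProjectionOnto y))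

/-- A bounded, open, connected (in particular nonempty) `C¹` domain of `ℝ^d`. -/
structure IsC1Domain (Ω : Set (Eu d)) : Prop where
  isOpen : IsOpen Ω
  isConnected : IsConnected Ω
  isBounded : Bornology.IsBounded Ω
  c1 : HasC1Boundary Ω

/-- The surface measure of `∂Ω`: the `(d-1)`-dimensional Hausdorff measure, normalised as usual so
that it is Lebesgue measure on hyperplanes, restricted to `∂Ω`. -/
def surf (Ω : Set (Eu d)) : Measure (Eu d) :=
  (Measure.euclideanHausdorffMeasure (d - 1) : Measure (Eu d)).restrict (frontier Ω)

/-- `ΓD` and `ΓN` are disjoint relatively open subsets of `∂Ω` whose closures cover `∂Ω` and meet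
in a set of surface measure zero. -/
structure IsBoundaryPartition (Ω ΓD ΓN : Set (Eu d)) : Prop where
  open_D : ∃ U, IsOpen U ∧ ΓD = U ∩ frontier Ω
  open_N : ∃ U, IsOpen U ∧ ΓN = U ∩ frontier Ω
  disjoint : Disjoint ΓD ΓN
  cover : closure ΓD ∪ closure ΓN = frontier Ω
  null_interface : surf Ω (closure ΓD ∩ closure ΓN) = 0

/-! ### Sobolev functions, traces, weak divergence, normal traces -/

/-- `v ∈ W^{1,q}(Ω)` with weak gradient `Dv`. -/
structure MemSobolev (Ω : Set (Eu d)) (q : ℝ) (v : Eu d → ℝ) (Dv : Eu d → Eu d) : Prop where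
  memLp : MemLp v (ENNReal.ofReal q) (volume.restrict Ω)
  memLp_grad : MemLp Dv (ENNReal.ofReal q) (volume.restrict Ω)
  weak_grad : ∀ φ : Eu d → ℝ, ContDiff ℝ ∞ φ → HasCompactSupport φ → tsupport φ ⊆ Ω →
    ∫ x in Ω, v x • gradient φ x = - ∫ x in Ω, φ x • Dv x

/-- `t ∈ L^q(∂Ω)` is the trace on `∂Ω` of the Sobolev function `v` (with weak gradient `Dv`): there
are functions `f n`, smooth up to the boundary, with `f n → v` in `W^{1,q}(Ω)` and
`f n → t` in `L^q(∂Ω)`. -/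
structure HasTrace (Ω : Set (Eu d)) (q : ℝ) (v : Eu d → ℝ) (Dv : Eu d → Eu d)
    (t : Eu d → ℝ) : Prop where
  memLp : MemLp t (ENNReal.ofReal q) (surf Ω)
  approx : ∃ f : ℕ → Eu d → ℝ, (∀ n, ContDiff ℝ ∞ (f n)) ∧
    Tendsto (fun n => eLpNorm (fun x => f n x - v x) (ENNReal.ofReal q) (volume.restrict Ω))
      atTop (𝓝 0) ∧
    Tendsto (fun n => eLpNorm (fun x => gradient (f n) x - Dv x) (ENNReal.ofReal q)
      (volume.restrict Ω)) atTop (𝓝 0) ∧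
    Tendsto (fun n => eLpNorm (fun x => f n x - t x) (ENNReal.ofReal q) (surf Ω)) atTop (𝓝 0)

/-- `f ∈ L¹(Ω)` is the distributional divergence in `Ω` of the vector field `Φ ∈ L¹(Ω)`. -/
structure IsWeakDiv (Ω : Set (Eu d)) (Φ : Eu d → Eu d) (f : Eu d → ℝ) : Prop where
  integrable : IntegrableOn Φ Ω
  integrable_div : IntegrableOn f Ω
  eq : ∀ φ : Eu d → ℝ, ContDiff ℝ ∞ φ → HasCompactSupport φ → tsupport φ ⊆ Ω →
    ∫ x in Ω, f x * φ x = - ∫ x in Ω, ⟪Φ x, gradient φ x⟫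

/-- The normal trace `Φ · ν` on `∂Ω` of a vector field `Φ ∈ L^{q'}(Ω)` with weak divergence
`f ∈ L^{q'}(Ω)`: the bounded functional which takes (the trace of) `v ∈ W^{1,q}(Ω)` to
`∫_Ω Φ · Dv + v f dx`. By the divergence theorem this is `∫_{∂Ω} v Φ · ν ds` for smooth `Φ`. -/
def normalTrace (Ω : Set (Eu d)) (Φ : Eu d → Eu d) (f : Eu d → ℝ)
    (v : Eu d → ℝ) (Dv : Eu d → Eu d) : ℝ :=
  ∫ x in Ω, (⟪Φ x, Dv x⟫ + v x * f x)

/-- The part on `Γ_D` of the normal trace of a divergence-free field `Φ` with `Φ · ν = j` on `Γ_N`: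
the functional "`∫_{Γ_D} v Φ · ν ds`", that is, the normal trace of `Φ` minus `∫_{Γ_N} j v ds`.
Here `t` is the trace of `v`. When `Φ · ν = j` on `Γ_N`, the value depends only on the restriction
of `t` to `Γ_D`. -/
def dirichletFlux (Ω ΓN : Set (Eu d)) (j : Eu d → ℝ) (Φ : Eu d → Eu d)
    (v : Eu d → ℝ) (Dv : Eu d → Eu d) (t : Eu d → ℝ) : ℝ :=
  normalTrace Ω Φ 0 v Dv - ∫ x in ΓN, j x * t x ∂(surf Ω)

/-- `w Φ · ν = 0` on `Γ_D` in the sense of normal traces, for a Sobolev function `w` with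
weak gradient `Dw` and trace `t`: for every `φ` smooth up to the boundary,
"`∫_{Γ_D} φ w Φ · ν ds = 0`". -/
def FluxProductVanishes (Ω ΓN : Set (Eu d)) (j : Eu d → ℝ) (Φ : Eu d → Eu d)
    (w : Eu d → ℝ) (Dw : Eu d → Eu d) (t : Eu d → ℝ) : Prop :=
  ∀ φ : Eu d → ℝ, ContDiff ℝ ∞ φ →
    dirichletFlux Ω ΓN j Φ (fun x => φ x * w x) (fun x => φ x • Dw x + w x • gradient φ x)
      (fun x => φ x * t x) = 0

/-- On `Γ_D` the normal trace of `Φ` is the (locally integrable) function `h`: the two agree on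
smooth functions whose support meets `∂Ω` only inside `Γ_D`. -/
def FluxIsFunction (Ω ΓD ΓN : Set (Eu d)) (j : Eu d → ℝ) (Φ : Eu d → Eu d)
    (h : Eu d → ℝ) : Prop :=
  ∀ φ : Eu d → ℝ, ContDiff ℝ ∞ φ → HasCompactSupport φ → tsupport φ ∩ frontier Ω ⊆ ΓD →
    IntegrableOn (fun x => h x * φ x) ΓD (surf Ω) ∧
    dirichletFlux Ω ΓN j Φ φ (gradient φ) φ = ∫ x in ΓD, h x * φ x ∂(surf Ω)

/-! ### The data -/

/-- Assumptions on the potential `G : ℝ → ℝ` of the coupling, with exponent `α > 1`. -/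
structure IsPotential (G : ℝ → ℝ) (α : ℝ) : Prop where
  c1 : ContDiff ℝ 1 G
  coercive : Tendsto G atTop atTop
  convex : ConvexOn ℝ univ G
  monotone : Monotone G
  one_lt : 1 < α
  growth : ∃ C > 0, ∀ᶠ z in atTop, |z| ^ α / C - C ≤ G z ∧ G z ≤ C * (|z| ^ α + 1) ∧
    |deriv G z| ≤ C * (|z| ^ (α - 1) + 1)
  lower : ∃ C > 0, ∀ᶠ z in atTop, - C ≤ deriv G z * z

/-- `g : [0,∞) → ℝ` is the pseudo-inverse of `G'`: `g μ = max {z | G' z = μ}` for all `μ ≥ 0`. -/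
def IsPseudoInverse (g G : ℝ → ℝ) : Prop :=
  ∀ μ : ℝ, 0 ≤ μ → IsGreatest {z : ℝ | deriv G z = μ} (g μ)

/-- Assumptions on the Hamiltonian `H : Ω̄ × ℝ^d → ℝ`, with exponent `β > 1`. The gradient of
`H x` at `p` is `D_p H(x,p)`, and the gradient of `fun y => H y p` at `x` is `D_x H(x,p)`. -/
structure IsHamiltonian (Ω : Set (Eu d)) (H : Eu d → Eu d → ℝ) (β : ℝ) : Prop where
  c2 : ContDiffOn ℝ 2 (fun z : Eu d × Eu d => H z.1 z.2) (closure Ω ×ˢ univ)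
  bddBelow : ∃ c : ℝ, ∀ x ∈ closure Ω, ∀ p, c ≤ H x p
  convex : ∀ x ∈ Ω, StrictConvexOn ℝ univ (H x)
  one_lt : 1 < β
  growth : ∃ C > 0, ∀ x ∈ Ω, ∀ p : Eu d,
    ‖p‖ ^ β / C - C ≤ H x p ∧ H x p ≤ C * (‖p‖ ^ β + 1) ∧
    ‖gradient (fun y => H y p) x‖ ≤ C * (‖p‖ ^ β + 1) ∧
    ‖gradient (H x) p‖ ≤ C * (‖p‖ ^ (β - 1) + 1)
  lower : ∃ C > 0, ∀ x ∈ Ω, ∀ p : Eu d,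
    ‖p‖ ^ β / C - C ≤ - H x p + ⟪gradient (H x) p, p⟫

/-- Assumptions on the incoming flow: `j ∈ L^{β'}(Γ_N)` and `j ≥ 0`. -/
structure IsInflow (Ω ΓN : Set (Eu d)) (j : Eu d → ℝ) (β : ℝ) : Prop where
  memLp : MemLp j (ENNReal.ofReal (Real.conjExponent β)) ((surf Ω).restrict ΓN)
  nonneg : ∀ᵐ x ∂(surf Ω).restrict ΓN, 0 ≤ j x

/-! ### Weak solutions -/

/-- The flow `m D_p H(x, Du)`. -/
def flow (H : Eu d → Eu d → ℝ) (m : Eu d → ℝ) (Du : Eu d → Eu d) (x : Eu d) : Eu d :=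
  m x • gradient (H x) (Du x)

/-- `(m, u) ∈ L^{α'}(Ω) × W^{1,γ}(Ω)`, `γ = α β`, is a weak solution of the mean-field game with
mixed boundary conditions. Here `Du` is the weak gradient of `u`, and `tu` its trace;
`Dψ` and `tψ` are those of the exit cost `ψ`. -/
structure IsWeakSolution (Ω ΓD ΓN : Set (Eu d)) (α β : ℝ) (H : Eu d → Eu d → ℝ) (g : ℝ → ℝ)
    (j : Eu d → ℝ) (ψ : Eu d → ℝ) (Dψ : Eu d → Eu d) (tψ : Eu d → ℝ)
    (m u : Eu d → ℝ) (Du : Eu d → Eu d) (tu : Eu d → ℝ) : Prop where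
  memLp_m : MemLp m (ENNReal.ofReal (Real.conjExponent α)) (volume.restrict Ω)
  sobolev_u : MemSobolev Ω (α * β) u Du
  trace_u : HasTrace Ω (α * β) u Du tu
  /-- `m ≥ 0` and `m D_p H(x, Du) ∈ L¹(Ω)`. -/
  nonneg : ∀ᵐ x ∂volume.restrict Ω, 0 ≤ m x
  flow_integrable : IntegrableOn (flow H m Du) Ω
  /-- The Hamilton-Jacobi equation. -/
  hj_eq : ∀ᵐ x ∂volume.restrict Ω, 0 < m x → H x (Du x) = g (m x)
  hj_le : ∀ᵐ x ∂volume.restrict Ω, H x (Du x) ≤ g (m x)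
  /-- `-div (m D_p H(x, Du)) = 0` in the sense of distributions. -/
  transport : IsWeakDiv Ω (flow H m Du) 0
  /-- `m D_p H(x, Du) · ν = j` on `Γ_N`: the normal trace is `j` on functions vanishing on `Γ_D`. -/
  neumann : ∀ v Dv t, MemSobolev Ω (α * β) v Dv → HasTrace Ω (α * β) v Dv t →
    (∀ᵐ x ∂(surf Ω).restrict ΓD, t x = 0) →
      normalTrace Ω (flow H m Du) 0 v Dv = ∫ x in ΓN, j x * t x ∂(surf Ω)
  /-- `m D_p H(x, Du) · ν ≤ 0` on `Γ_D`. -/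
  exit : ∀ v Dv t, MemSobolev Ω (α * β) v Dv → HasTrace Ω (α * β) v Dv t →
    (∀ᵐ x ∂(surf Ω).restrict ΓD, 0 ≤ t x) →
      dirichletFlux Ω ΓN j (flow H m Du) v Dv t ≤ 0
  /-- `u ≤ ψ` on `Γ_D`. -/
  le_exit_cost : ∀ᵐ x ∂(surf Ω).restrict ΓD, tu x ≤ tψ x
  /-- `(ψ - u) m D_p H(x, Du) · ν = 0` on `Γ_D`. -/
  contact : FluxProductVanishes Ω ΓN j (flow H m Du)
    (fun x => ψ x - u x) (fun x => Dψ x - Du x) (fun x => tψ x - tu x)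

end MixedMFG

end

open MixedMFG

/-!
Write `Φ` and `Ψ` for the flows of `(m, u)` and `(η, ξ)`, and `F_Φ`, `F_Ψ` for their fluxes through
`Γ_D`. As both flows have the same flux `j` through `Γ_N`, the contact conditions
`F_Φ (ψ - u) = F_Ψ (ψ - ξ) = 0` give
`∫_Ω (Φ - Ψ) · (Du - Dξ) dx = F_Φ (u - ξ) - F_Ψ (u - ξ) = F_Φ (ψ - ξ) + F_Ψ (ψ - u) ≤ 0`,
because `ξ, u ≤ ψ` on `Γ_D` and the flows are outgoing there. Convexity of `H` and strict
monotonicity of `g` make the integrand nonnegative (Lasry-Lions), so all these terms vanish.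
Equality in the pointwise inequality gives `η = m`, and `Du = Dξ` where `m > 0`. As `F_Ψ` has a sign
and `ψ - u ≥ 0` on `Γ_D`, vanishing of `F_Ψ (ψ - u)` gives `(ψ - u) Ψ · ν = 0` by comparison. When
`Ψ · ν` is a function, it is tested against `φ arctan (ψ - u)`: unlike that of `φ (ψ - u)`, the
trace is bounded, hence integrable against a merely locally integrable function.
-/

noncomputable section

namespace MixedMFG

variable {d : ℕ}

section LpConvergence

variable {X E F G : Type*} [MeasurableSpace X] {μ : Measure X} {p : ENNReal}
  [NormedAddCommGroup E] [NormedAddCommGroup F] [NormedAddCommGroup G]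

/-- Convergence of `f n` to `f₀` in `L^p(μ)`. Only the limit is required to lie in `L^p(μ)`, so that
`f n` lies there from some index on. -/
structure TendstoInLp (p : ENNReal) (μ : Measure X) (f : ℕ → X → E) (f₀ : X → E) : Prop where
  memLp : MemLp f₀ p μ
  aestronglyMeasurable : ∀ n, AEStronglyMeasurable (f n) μ
  tendsto : Tendsto (fun n => eLpNorm (fun x => f n x - f₀ x) p μ) atTop (𝓝 0)

variable {f g : ℕ → X → E} {f₀ g₀ : X → E}

theorem TendstoInLp.comp_tendsto (hf : TendstoInLp p μ f f₀) {k : ℕ → ℕ}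
    (hk : Tendsto k atTop atTop) : TendstoInLp p μ (fun n => f (k n)) f₀ :=
  ⟨hf.memLp, fun _ => hf.aestronglyMeasurable _, hf.tendsto.comp hk⟩

theorem TendstoInLp.mono_measure {ν : Measure X} (hf : TendstoInLp p μ f f₀) (hν : ν ≤ μ) :
    TendstoInLp p ν f f₀ :=
  ⟨hf.memLp.mono_measure hν, fun n => (hf.aestronglyMeasurable n).mono_measure hν,
    tendsto_nhds_bot_mono' hf.tendsto fun _ => eLpNorm_mono_measure _ hν⟩

theorem TendstoInLp.eventually_memLp (hf : TendstoInLp p μ f f₀) :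
    ∀ᶠ n in atTop, MemLp (f n) p μ := by
  filter_upwards [hf.tendsto.eventually_lt_const ENNReal.zero_lt_top] with n hn
  have hsub : MemLp (fun x => f n x - f₀ x) p μ :=
    ⟨(hf.aestronglyMeasurable n).sub hf.memLp.aestronglyMeasurable, hn⟩
  simpa only [Pi.add_def, sub_add_cancel] using hsub.add hf.memLp

theorem TendstoInLp.exists_seq_tendsto_ae (hp : p ≠ 0) (hf : TendstoInLp p μ f f₀) :
    ∃ k : ℕ → ℕ, StrictMono k ∧ ∀ᵐ x ∂μ, Tendsto (fun n => f (k n) x) atTop (𝓝 (f₀ x)) :=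
  (tendstoInMeasure_of_tendsto_eLpNorm hp hf.aestronglyMeasurable hf.memLp.aestronglyMeasurable
    hf.tendsto).exists_seq_tendsto_ae

theorem tendsto_eLpNorm_add_zero (hp : 1 ≤ p) (hf : ∀ n, AEStronglyMeasurable (f n) μ)
    (hg : ∀ n, AEStronglyMeasurable (g n) μ)
    (hf₀ : Tendsto (fun n => eLpNorm (f n) p μ) atTop (𝓝 0))
    (hg₀ : Tendsto (fun n => eLpNorm (g n) p μ) atTop (𝓝 0)) :
    Tendsto (fun n => eLpNorm (fun x => f n x + g n x) p μ) atTop (𝓝 0) := by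
  have hsum := hf₀.add hg₀
  rw [add_zero] at hsum
  exact tendsto_nhds_bot_mono' hsum fun n => eLpNorm_add_le (hf n) (hg n) hp

theorem tendsto_eLpNorm_zero_of_le_mul {u : ℕ → X → E} {v : ℕ → X → F} {C : ℝ}
    (huv : ∀ n, ∀ᵐ x ∂μ, ‖u n x‖ ≤ C * ‖v n x‖)
    (hv : Tendsto (fun n => eLpNorm (v n) p μ) atTop (𝓝 0)) :
    Tendsto (fun n => eLpNorm (u n) p μ) atTop (𝓝 0) := by
  have hCv := ENNReal.Tendsto.const_mul (a := ENNReal.ofReal C) hv (.inr ENNReal.ofReal_ne_top)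
  rw [mul_zero] at hCv
  exact tendsto_nhds_bot_mono' hCv fun n => eLpNorm_le_mul_eLpNorm_of_ae_le_mul (huv n) p

theorem tendsto_eLpNorm_zero_of_dominated (hp₀ : p ≠ 0) (hp : p ≠ ⊤) {b : X → ℝ}
    (hf : ∀ n, AEStronglyMeasurable (f n) μ) (hb : MemLp b p μ)
    (hfb : ∀ n, ∀ᵐ x ∂μ, ‖f n x‖ ≤ b x) (hlim : ∀ᵐ x ∂μ, Tendsto (fun n => f n x) atTop (𝓝 0)) :
    Tendsto (fun n => eLpNorm (f n) p μ) atTop (𝓝 0) := by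
  have hpos := ENNReal.toReal_pos hp₀ hp
  simp only [eLpNorm_eq_lintegral_rpow_enorm_toReal hp₀ hp]
  have hlintegral : Tendsto (fun n => ∫⁻ x, ‖f n x‖ₑ ^ p.toReal ∂μ) atTop (𝓝 (∫⁻ _, 0 ∂μ)) := by
    refine tendsto_lintegral_of_dominated_convergence' (fun x => ‖b x‖ₑ ^ p.toReal)
      (fun n => (hf n).enorm.pow_const _) (fun n => ?_)
      (lintegral_rpow_enorm_lt_top_of_eLpNorm_lt_top hp₀ hp hb.2).ne ?_
    · filter_upwards [hfb n] with x hx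
      exact ENNReal.rpow_le_rpow (enorm_le_iff_norm_le.2 (hx.trans (le_abs_self _))) hpos.le
    · filter_upwards [hlim] with x hx
      simpa [hpos] using hx.enorm.ennrpow_const p.toReal
  simpa [hpos] using hlintegral.ennrpow_const (1 / p.toReal)

theorem TendstoInLp.add (hp : 1 ≤ p) (hf : TendstoInLp p μ f f₀) (hg : TendstoInLp p μ g g₀) :
    TendstoInLp p μ (fun n x => f n x + g n x) (fun x => f₀ x + g₀ x) where
  memLp := hf.memLp.add hg.memLp
  aestronglyMeasurable n := (hf.aestronglyMeasurable n).add (hg.aestronglyMeasurable n)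
  tendsto := by
    simpa only [Pi.sub_apply, add_sub_add_comm] using tendsto_eLpNorm_add_zero hp
      (fun n => (hf.aestronglyMeasurable n).sub hf.memLp.aestronglyMeasurable)
      (fun n => (hg.aestronglyMeasurable n).sub hg.memLp.aestronglyMeasurable)
      hf.tendsto hg.tendsto

theorem TendstoInLp.comp_lipschitzWith {θ : E → F} {K : NNReal} (hθ : LipschitzWith K θ)
    (hθ₀ : θ 0 = 0) (hf : TendstoInLp p μ f f₀) :
    TendstoInLp p μ (fun n x => θ (f n x)) (fun x => θ (f₀ x)) where
  memLp := hθ.comp_memLp hθ₀ hf.memLp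
  aestronglyMeasurable n := hθ.continuous.comp_aestronglyMeasurable (hf.aestronglyMeasurable n)
  tendsto := tendsto_eLpNorm_zero_of_le_mul (fun _ => .of_forall fun _ => hθ.norm_sub_le _ _)
    hf.tendsto

variable [NormedSpace ℝ E] [NormedSpace ℝ F] [NormedSpace ℝ G]

theorem TendstoInLp.bilin_of_bound (hp : 1 ≤ p) (hp' : p ≠ ⊤) (B : F →L[ℝ] E →L[ℝ] G)
    {c : ℕ → X → F} {c₀ : X → F} {C : ℝ} (hc : ∀ n, AEStronglyMeasurable (c n) μ)
    (hC : ∀ n, ∀ᵐ x ∂μ, ‖c n x‖ ≤ C) (hlim : ∀ᵐ x ∂μ, Tendsto (fun n => c n x) atTop (𝓝 (c₀ x)))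
    (hf : TendstoInLp p μ f f₀) :
    TendstoInLp p μ (fun n x => B (c n x) (f n x)) (fun x => B (c₀ x) (f₀ x)) := by
  have hc₀ : AEStronglyMeasurable c₀ μ := aestronglyMeasurable_of_tendsto_ae atTop hc hlim
  have hC₀ : ∀ᵐ x ∂μ, ‖c₀ x‖ ≤ C := by
    filter_upwards [hlim, ae_all_iff.2 hC] with x hx hCx
    exact le_of_tendsto' hx.norm hCx
  have hf₀ := hf.memLp.aestronglyMeasurable
  have hB : ∀ {a : F} {D : ℝ} (y : E), ‖a‖ ≤ D → ‖B a y‖ ≤ ‖B‖ * D * ‖y‖ := fun y ha =>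
    (B.le_opNorm₂ _ _).trans (by gcongr)
  refine ⟨hf.memLp.of_le_mul (B.aestronglyMeasurable_comp₂ hc₀ hf₀) (hC₀.mono fun x => hB _),
    fun n => B.aestronglyMeasurable_comp₂ (hc n) (hf.aestronglyMeasurable n), ?_⟩
  have hdiff n := (hf.aestronglyMeasurable n).sub hf₀
  have hfactor : Tendsto (fun n => eLpNorm (fun x => B (c n x - c₀ x) (f₀ x)) p μ) atTop (𝓝 0) := by
    refine tendsto_eLpNorm_zero_of_dominated (zero_lt_one.trans_le hp).ne' hp'
      (fun n => B.aestronglyMeasurable_comp₂ ((hc n).sub hc₀) hf₀)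
      (hf.memLp.norm.const_mul (‖B‖ * (C + C))) (fun n => ?_) (hlim.mono fun x hx => ?_)
    · filter_upwards [hC n, hC₀] with x hx hx₀
      exact hB _ ((norm_sub_le _ _).trans (add_le_add hx hx₀))
    · simpa [Function.comp_def] using
        ((B.flip (f₀ x)).continuous.tendsto 0).comp (tendsto_sub_nhds_zero_iff.2 hx)
  refine (tendsto_eLpNorm_add_zero hp (fun n => B.aestronglyMeasurable_comp₂ (hc n) (hdiff n))
    (fun n => B.aestronglyMeasurable_comp₂ ((hc n).sub hc₀) hf₀)
    (tendsto_eLpNorm_zero_of_le_mul (fun n => (hC n).mono fun x => hB _) hf.tendsto)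
    hfactor).congr fun n => ?_
  congr 1
  ext x
  simp

theorem TendstoInLp.bilin_left_of_bound (hp : 1 ≤ p) (hp' : p ≠ ⊤) (B : F →L[ℝ] E →L[ℝ] G)
    {c : X → F} {C : ℝ} (hc : AEStronglyMeasurable c μ) (hC : ∀ᵐ x ∂μ, ‖c x‖ ≤ C)
    (hf : TendstoInLp p μ f f₀) :
    TendstoInLp p μ (fun n x => B (c x) (f n x)) (fun x => B (c x) (f₀ x)) :=
  hf.bilin_of_bound hp hp' B (fun _ => hc) (fun _ => hC) (.of_forall fun _ => tendsto_const_nhds)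

variable {p' : ENNReal} [ENNReal.HolderConjugate p' p] {Φ : X → F}

theorem integrable_bilin (B : F →L[ℝ] E →L[ℝ] G) (hΦ : MemLp Φ p' μ) (hf₀ : MemLp f₀ p μ) :
    Integrable (fun x => B (Φ x) (f₀ x)) μ :=
  memLp_one_iff_integrable.1 (B.memLp_of_bilin 1 hΦ hf₀)

theorem TendstoInLp.tendsto_integral_bilin (B : F →L[ℝ] E →L[ℝ] G)
    (hΦ : MemLp Φ p' μ) (hf : TendstoInLp p μ f f₀) :
    Tendsto (fun n => ∫ x, B (Φ x) (f n x) ∂μ) atTop (𝓝 (∫ x, B (Φ x) (f₀ x) ∂μ)) := by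
  refine tendsto_integral_of_L1' _ (integrable_bilin B hΦ hf.memLp).aestronglyMeasurable
    (hf.eventually_memLp.mono fun n hn => integrable_bilin B hΦ hn) ?_
  have hbound n := eLpNorm_le_eLpNorm_mul_eLpNorm'_of_norm (p := p') (q := p) (r := 1)
    hΦ.aestronglyMeasurable ((hf.aestronglyMeasurable n).sub hf.memLp.aestronglyMeasurable)
    (fun y z => B y z) ‖B‖₊ (.of_forall fun x => B.le_opNorm₂ _ _)
  have hlim := ENNReal.Tendsto.const_mul (a := ‖B‖₊ * eLpNorm Φ p' μ) hf.tendsto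
    (.inr (ENNReal.mul_ne_top ENNReal.coe_ne_top hΦ.eLpNorm_ne_top))
  rw [mul_zero] at hlim
  refine tendsto_nhds_bot_mono' hlim fun n => ?_
  simpa only [Pi.sub_def, Pi.sub_apply, map_sub] using hbound n

end LpConvergence

section Gradient

variable {E : Type*} [NormedAddCommGroup E] [InnerProductSpace ℝ E] [CompleteSpace E]
  {f g : E → ℝ} {x : E}

theorem continuous_gradient {n : WithTop ℕ∞} (hf : ContDiff ℝ n f) (hn : n ≠ 0) :
    Continuous (gradient f) :=
  (InnerProductSpace.toDual ℝ E).symm.continuous.comp (hf.continuous_fderiv hn)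

theorem gradient_fun_add (hf : DifferentiableAt ℝ f x) (hg : DifferentiableAt ℝ g x) :
    gradient (fun y => f y + g y) x = gradient f x + gradient g x := by
  simp [gradient, fderiv_fun_add hf hg]

theorem gradient_fun_mul (hf : DifferentiableAt ℝ f x) (hg : DifferentiableAt ℝ g x) :
    gradient (fun y => f y * g y) x = f x • gradient g x + g x • gradient f x := by
  simp [gradient, fderiv_fun_mul hf hg]

theorem gradient_comp {θ : ℝ → ℝ} (hθ : DifferentiableAt ℝ θ (f x)) (hf : DifferentiableAt ℝ f x) :
    gradient (fun y => θ (f y)) x = deriv θ (f x) • gradient f x := by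
  have hcomp : fderiv ℝ (fun y => θ (f y)) x = deriv θ (f x) • fderiv ℝ f x :=
    (hθ.hasDerivAt.comp_hasFDerivAt x hf.hasFDerivAt).fderiv
  simp [gradient, hcomp]

theorem support_gradient_subset : Function.support (gradient f) ⊆ tsupport f := fun x hx =>
  support_fderiv_subset ℝ fun h => hx (by simp [gradient, h])

theorem integral_smul_gradient [FiniteDimensional ℝ E] [MeasurableSpace E] [BorelSpace E]
    (hf : ContDiff ℝ 1 f) (hg : ContDiff ℝ 1 g) (hgc : HasCompactSupport g) :
    ∫ x, f x • gradient g x = -∫ x, g x • gradient f x := by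
  have hgc' : HasCompactSupport (gradient g) := hgc.mono' support_gradient_subset
  have hfDg : Integrable (fun x => f x • gradient g x) :=
    (hf.continuous.smul (continuous_gradient hg one_ne_zero)).integrable_of_hasCompactSupport
      hgc'.smul_left
  have hgDf : Integrable (fun x => g x • gradient f x) :=
    (hg.continuous.smul (continuous_gradient hf one_ne_zero)).integrable_of_hasCompactSupport
      hgc.smul_right
  have hfg : Integrable (fun x => f x * g x) :=
    (hf.continuous.mul hg.continuous).integrable_of_hasCompactSupport hgc.mul_left
  refine ext_inner_left ℝ fun w => ?_
  rw [inner_neg_right, ← integral_inner (𝕜 := ℝ) hfDg, ← integral_inner (𝕜 := ℝ) hgDf]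
  have hfDg_w := hfDg.const_inner (𝕜 := ℝ) w
  have hgDf_w := hgDf.const_inner (𝕜 := ℝ) w
  simp only [inner_smul_right, inner_gradient_right, conj_trivial, mul_comm (g _)]
    at hfDg_w hgDf_w ⊢
  exact integral_mul_fderiv_eq_neg_fderiv_mul_of_integrable hgDf_w hfDg_w hfg
    (fun x _ => hf.differentiable one_ne_zero x) (fun x _ => hg.differentiable one_ne_zero x)

theorem setIntegral_smul_gradient [FiniteDimensional ℝ E] [MeasurableSpace E] [BorelSpace E]
    (hf : ContDiff ℝ 1 f) (hg : ContDiff ℝ 1 g) (hgc : HasCompactSupport g) {s : Set E}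
    (hgs : tsupport g ⊆ s) : ∫ x in s, f x • gradient g x = -∫ x in s, g x • gradient f x := by
  rw [setIntegral_eq_integral_of_forall_compl_eq_zero, integral_smul_gradient hf hg hgc,
    setIntegral_eq_integral_of_forall_compl_eq_zero]
  · intro x hx
    rw [image_eq_zero_of_notMem_tsupport (fun h => hx (hgs h)), zero_smul]
  · intro x hx
    rw [Function.notMem_support.1 fun h => hx (hgs (support_gradient_subset h)), smul_zero]

end Gradient

section Sobolev

variable {Ω : Set (Eu d)} {q : ℝ} {v w : Eu d → ℝ} {Dv Dw : Eu d → Eu d} {t s : Eu d → ℝ}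
  {f g : ℕ → Eu d → ℝ}

theorem holderConjugate_ofReal_conjExponent (hq : 1 < q) :
    ENNReal.HolderConjugate (ENNReal.ofReal q.conjExponent) (ENNReal.ofReal q) :=
  (Real.HolderConjugate.conjExponent hq).symm.ennrealOfReal

/-- The functions `f n`, smooth up to the boundary, converge to `v` in `W^{1,q}(Ω)` with weak
gradient `Dv`, and to the trace `t` in `L^q(∂Ω)`. The sequence is a parameter, so that an operation
on Sobolev functions can be carried out on the approximations. -/
structure IsTraceApprox (Ω : Set (Eu d)) (q : ℝ) (v : Eu d → ℝ) (Dv : Eu d → Eu d) (t : Eu d → ℝ)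
    (f : ℕ → Eu d → ℝ) : Prop where
  contDiff : ∀ n, ContDiff ℝ ∞ (f n)
  interior : TendstoInLp (ENNReal.ofReal q) (volume.restrict Ω) f v
  grad : TendstoInLp (ENNReal.ofReal q) (volume.restrict Ω) (fun n => gradient (f n)) Dv
  boundary : TendstoInLp (ENNReal.ofReal q) (surf Ω) f t

/-- `v ∈ W^{1,q}(Ω)` has weak gradient `Dv` and trace `t`, that is, `MemSobolev` and `HasTrace` hold
together (`isTracedSobolev_iff`). -/
def IsTracedSobolev (Ω : Set (Eu d)) (q : ℝ) (v : Eu d → ℝ) (Dv : Eu d → Eu d) (t : Eu d → ℝ) :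
    Prop :=
  ∃ f, IsTraceApprox Ω q v Dv t f

theorem IsTraceApprox.differentiableAt (hf : IsTraceApprox Ω q v Dv t f) (n : ℕ) (x : Eu d) :
    DifferentiableAt ℝ (f n) x :=
  (hf.contDiff n).differentiable (by simp) x

theorem IsTraceApprox.comp_tendsto (hf : IsTraceApprox Ω q v Dv t f) {k : ℕ → ℕ}
    (hk : Tendsto k atTop atTop) : IsTraceApprox Ω q v Dv t (fun n => f (k n)) :=
  ⟨fun _ => hf.contDiff _, hf.interior.comp_tendsto hk, hf.grad.comp_tendsto hk,
    hf.boundary.comp_tendsto hk⟩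

theorem IsTraceApprox.hasTrace (hf : IsTraceApprox Ω q v Dv t f) : HasTrace Ω q v Dv t :=
  ⟨hf.boundary.memLp, f, hf.contDiff, hf.interior.tendsto, hf.grad.tendsto, hf.boundary.tendsto⟩

theorem IsTraceApprox.memSobolev (hq : 1 < q) (hf : IsTraceApprox Ω q v Dv t f) :
    MemSobolev Ω q v Dv := by
  refine ⟨hf.interior.memLp, hf.grad.memLp, fun φ hφ hφc hφΩ => ?_⟩
  have := holderConjugate_ofReal_conjExponent hq
  have hφ_mem : MemLp φ (ENNReal.ofReal q.conjExponent) (volume.restrict Ω) :=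
    (hφ.continuous.memLp_of_hasCompactSupport hφc).restrict Ω
  have hDφ_mem : MemLp (gradient φ) (ENNReal.ofReal q.conjExponent) (volume.restrict Ω) :=
    ((continuous_gradient hφ (by simp)).memLp_of_hasCompactSupport
      (hφc.mono' support_gradient_subset)).restrict Ω
  have hleft := hf.interior.tendsto_integral_bilin (.flip (.lsmul ℝ ℝ)) hDφ_mem
  have hright := hf.grad.tendsto_integral_bilin (.lsmul ℝ ℝ) hφ_mem
  exact tendsto_nhds_unique hleft <| hright.neg.congr fun n =>
    (setIntegral_smul_gradient ((hf.contDiff n).of_le (by simp)) (hφ.of_le (by simp)) hφc hφΩ).symm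

theorem isTracedSobolev_iff (hq : 1 < q) :
    IsTracedSobolev Ω q v Dv t ↔ MemSobolev Ω q v Dv ∧ HasTrace Ω q v Dv t := by
  refine ⟨fun ⟨f, hf⟩ => ⟨hf.memSobolev hq, hf.hasTrace⟩, fun ⟨hv, ht⟩ => ?_⟩
  obtain ⟨f, hf, hinterior, hgrad, hboundary⟩ := ht.approx
  exact ⟨f, hf, ⟨hv.memLp, fun n => (hf n).continuous.aestronglyMeasurable, hinterior⟩,
    ⟨hv.memLp_grad, fun n => (continuous_gradient (hf n) (by simp)).aestronglyMeasurable, hgrad⟩,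
    ⟨ht.memLp, fun n => (hf n).continuous.aestronglyMeasurable, hboundary⟩⟩

theorem IsTracedSobolev.memLp_grad (hv : IsTracedSobolev Ω q v Dv t) :
    MemLp Dv (ENNReal.ofReal q) (volume.restrict Ω) :=
  let ⟨_, hf⟩ := hv
  hf.grad.memLp

theorem IsTracedSobolev.memLp_trace (hv : IsTracedSobolev Ω q v Dv t) :
    MemLp t (ENNReal.ofReal q) (surf Ω) :=
  let ⟨_, hf⟩ := hv
  hf.boundary.memLp

theorem IsTracedSobolev.exists_approx_tendsto_ae (hq : 0 < q) (hv : IsTracedSobolev Ω q v Dv t) :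
    ∃ f, IsTraceApprox Ω q v Dv t f ∧
      (∀ᵐ x ∂volume.restrict Ω, Tendsto (fun n => f n x) atTop (𝓝 (v x))) ∧
      ∀ᵐ x ∂surf Ω, Tendsto (fun n => f n x) atTop (𝓝 (t x)) := by
  obtain ⟨f, hf⟩ := hv
  have hq₀ : ENNReal.ofReal q ≠ 0 := by simpa using hq
  obtain ⟨k, hk, hinterior⟩ := hf.interior.exists_seq_tendsto_ae hq₀
  have hfk := hf.comp_tendsto hk.tendsto_atTop
  obtain ⟨l, hl, hboundary⟩ := hfk.boundary.exists_seq_tendsto_ae hq₀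
  exact ⟨_, hfk.comp_tendsto hl.tendsto_atTop,
    hinterior.mono fun x hx => hx.comp hl.tendsto_atTop, hboundary⟩

theorem IsTraceApprox.add (hq : 1 ≤ q) (hf : IsTraceApprox Ω q v Dv t f)
    (hg : IsTraceApprox Ω q w Dw s g) :
    IsTraceApprox Ω q (fun x => v x + w x) (fun x => Dv x + Dw x) (fun x => t x + s x)
      (fun n x => f n x + g n x) := by
  have hq' : 1 ≤ ENNReal.ofReal q := by simpa using hq
  refine ⟨fun n => (hf.contDiff n).add (hg.contDiff n), hf.interior.add hq' hg.interior, ?_,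
    hf.boundary.add hq' hg.boundary⟩
  have hgrad : (fun n => gradient fun x => f n x + g n x) =
      fun n x => gradient (f n) x + gradient (g n) x :=
    funext₂ fun n x => gradient_fun_add (hf.differentiableAt n x) (hg.differentiableAt n x)
  rw [hgrad]
  exact hf.grad.add hq' hg.grad

theorem ae_restrict_mem_closure : ∀ᵐ x ∂volume.restrict Ω, x ∈ closure Ω :=
  ae_restrict_of_ae_restrict_of_subset subset_closure
    (ae_restrict_mem isClosed_closure.measurableSet)

theorem ae_surf_mem_closure : ∀ᵐ x ∂surf Ω, x ∈ closure Ω :=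
  (ae_restrict_mem isClosed_frontier.measurableSet).mono fun _ hx => frontier_subset_closure hx

theorem IsTraceApprox.smooth_mul (hΩ : Bornology.IsBounded Ω) (hq : 1 ≤ q)
    (hf : IsTraceApprox Ω q v Dv t f) {φ : Eu d → ℝ} (hφ : ContDiff ℝ ∞ φ) :
    IsTraceApprox Ω q (fun x => φ x * v x) (fun x => φ x • Dv x + v x • gradient φ x)
      (fun x => φ x * t x) (fun n x => φ x * f n x) := by
  have hq' : 1 ≤ ENNReal.ofReal q := by simpa using hq
  have hq_top : ENNReal.ofReal q ≠ ⊤ := ENNReal.ofReal_ne_top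
  have hDφ := continuous_gradient hφ (by simp)
  obtain ⟨C, hC⟩ := hΩ.isCompact_closure.exists_bound_of_continuousOn hφ.continuous.continuousOn
  obtain ⟨C', hC'⟩ := hΩ.isCompact_closure.exists_bound_of_continuousOn hDφ.continuousOn
  refine ⟨fun n => hφ.mul (hf.contDiff n), ?_, ?_, ?_⟩
  · exact hf.interior.bilin_left_of_bound hq' hq_top (.lsmul ℝ ℝ)
      hφ.continuous.aestronglyMeasurable (ae_restrict_mem_closure.mono hC)
  · have hsum := (hf.grad.bilin_left_of_bound hq' hq_top (.lsmul ℝ ℝ)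
      hφ.continuous.aestronglyMeasurable (ae_restrict_mem_closure.mono hC)).add hq'
      (hf.interior.bilin_left_of_bound hq' hq_top (.flip (.lsmul ℝ ℝ))
        hDφ.aestronglyMeasurable (ae_restrict_mem_closure.mono hC'))
    have hgrad : (fun n => gradient fun x => φ x * f n x) =
        fun n x => φ x • gradient (f n) x + f n x • gradient φ x :=
      funext₂ fun n x => gradient_fun_mul (hφ.differentiable (by simp) x) (hf.differentiableAt n x)
    rw [hgrad]
    exact hsum
  · exact hf.boundary.bilin_left_of_bound hq' hq_top (.lsmul ℝ ℝ)
      hφ.continuous.aestronglyMeasurable (ae_surf_mem_closure.mono hC)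

theorem IsTraceApprox.comp_lipschitzWith (hq : 1 ≤ q) (hf : IsTraceApprox Ω q v Dv t f)
    (hfv : ∀ᵐ x ∂volume.restrict Ω, Tendsto (fun n => f n x) atTop (𝓝 (v x))) {θ : ℝ → ℝ}
    {K : NNReal} (hθ : ContDiff ℝ ∞ θ) (hθK : LipschitzWith K θ) (hθ₀ : θ 0 = 0) :
    IsTraceApprox Ω q (fun x => θ (v x)) (fun x => deriv θ (v x) • Dv x) (fun x => θ (t x))
      (fun n x => θ (f n x)) := by
  have hθ' : Continuous (deriv θ) := hθ.continuous_deriv (by simp)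
  refine ⟨fun n => hθ.comp (hf.contDiff n), hf.interior.comp_lipschitzWith hθK hθ₀, ?_,
    hf.boundary.comp_lipschitzWith hθK hθ₀⟩
  have hchain := hf.grad.bilin_of_bound (by simpa using hq) ENNReal.ofReal_ne_top (.lsmul ℝ ℝ)
    (fun n => (hθ'.comp (hf.contDiff n).continuous).aestronglyMeasurable)
    (fun n => .of_forall fun x => norm_deriv_le_of_lipschitz (x₀ := f n x) hθK)
    (hfv.mono fun x hx => (hθ'.tendsto (v x)).comp hx)
  have hgrad : (fun n => gradient fun x => θ (f n x)) =
      fun n x => deriv θ (f n x) • gradient (f n) x :=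
    funext₂ fun n x => gradient_comp (hθ.differentiable (by simp) _) (hf.differentiableAt n x)
  rw [hgrad]
  exact hchain

theorem IsTracedSobolev.add (hq : 1 ≤ q) (hv : IsTracedSobolev Ω q v Dv t)
    (hw : IsTracedSobolev Ω q w Dw s) :
    IsTracedSobolev Ω q (fun x => v x + w x) (fun x => Dv x + Dw x) (fun x => t x + s x) :=
  let ⟨_, hf⟩ := hv
  let ⟨_, hg⟩ := hw
  ⟨_, hf.add hq hg⟩

theorem IsTracedSobolev.smooth_mul (hΩ : Bornology.IsBounded Ω) (hq : 1 ≤ q)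
    (hv : IsTracedSobolev Ω q v Dv t) {φ : Eu d → ℝ} (hφ : ContDiff ℝ ∞ φ) :
    IsTracedSobolev Ω q (fun x => φ x * v x) (fun x => φ x • Dv x + v x • gradient φ x)
      (fun x => φ x * t x) :=
  let ⟨_, hf⟩ := hv
  ⟨_, hf.smooth_mul hΩ hq hφ⟩

theorem IsTracedSobolev.comp_lipschitzWith (hq : 1 ≤ q) (hv : IsTracedSobolev Ω q v Dv t)
    {θ : ℝ → ℝ} {K : NNReal} (hθ : ContDiff ℝ ∞ θ) (hθK : LipschitzWith K θ) (hθ₀ : θ 0 = 0) :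
    IsTracedSobolev Ω q (fun x => θ (v x)) (fun x => deriv θ (v x) • Dv x) (fun x => θ (t x)) :=
  let ⟨_, hf, hinterior, _⟩ := hv.exists_approx_tendsto_ae (by linarith)
  ⟨_, hf.comp_lipschitzWith hq hinterior hθ hθK hθ₀⟩

theorem IsTracedSobolev.const_mul (hΩ : Bornology.IsBounded Ω) (hq : 1 ≤ q)
    (hv : IsTracedSobolev Ω q v Dv t) (c : ℝ) :
    IsTracedSobolev Ω q (fun x => c * v x) (fun x => c • Dv x) (fun x => c * t x) := by
  simpa [gradient_fun_const] using hv.smooth_mul hΩ hq (contDiff_const (c := c))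

theorem IsTracedSobolev.sub (hΩ : Bornology.IsBounded Ω) (hq : 1 ≤ q)
    (hv : IsTracedSobolev Ω q v Dv t) (hw : IsTracedSobolev Ω q w Dw s) :
    IsTracedSobolev Ω q (fun x => v x - w x) (fun x => Dv x - Dw x) (fun x => t x - s x) := by
  simpa [sub_eq_add_neg] using hv.add hq (hw.const_mul hΩ hq (-1))

end Sobolev

section Flux

variable {Ω ΓD ΓN : Set (Eu d)} {q : ℝ} {v w : Eu d → ℝ} {Dv Dw : Eu d → Eu d} {t s : Eu d → ℝ}
  {j h : Eu d → ℝ} {Φ Ψ : Eu d → Eu d}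

theorem dirichletFlux_eq : dirichletFlux Ω ΓN j Φ v Dv t =
    (∫ x in Ω, ⟪Φ x, Dv x⟫) - ∫ x in ΓN, j x * t x ∂surf Ω := by
  simp [dirichletFlux, normalTrace]

theorem IsTracedSobolev.integrable_inner_grad (hq : 1 < q) (hv : IsTracedSobolev Ω q v Dv t)
    (hΦ : MemLp Φ (ENNReal.ofReal q.conjExponent) (volume.restrict Ω)) :
    IntegrableOn (fun x => ⟪Φ x, Dv x⟫) Ω :=
  have := holderConjugate_ofReal_conjExponent hq
  integrable_bilin (innerSL ℝ) hΦ hv.memLp_grad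

theorem IsTracedSobolev.integrable_mul_trace (hq : 1 < q) (hv : IsTracedSobolev Ω q v Dv t)
    (hj : MemLp j (ENNReal.ofReal q.conjExponent) ((surf Ω).restrict ΓN)) :
    IntegrableOn (fun x => j x * t x) ΓN (surf Ω) :=
  have := holderConjugate_ofReal_conjExponent hq
  integrable_bilin (.mul ℝ ℝ) hj (hv.memLp_trace.restrict ΓN)

theorem dirichletFlux_sub_dirichletFlux (hq : 1 < q)
    (hΦ : MemLp Φ (ENNReal.ofReal q.conjExponent) (volume.restrict Ω))
    (hΨ : MemLp Ψ (ENNReal.ofReal q.conjExponent) (volume.restrict Ω))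
    (hv : IsTracedSobolev Ω q v Dv t) :
    dirichletFlux Ω ΓN j Φ v Dv t - dirichletFlux Ω ΓN j Ψ v Dv t =
      ∫ x in Ω, ⟪Φ x - Ψ x, Dv x⟫ := by
  simp only [dirichletFlux_eq, inner_sub_left]
  rw [integral_sub (hv.integrable_inner_grad hq hΦ) (hv.integrable_inner_grad hq hΨ)]
  ring

theorem dirichletFlux_const_mul (c : ℝ) :
    dirichletFlux Ω ΓN j Φ (fun x => c * v x) (fun x => c • Dv x) (fun x => c * t x) =
      c * dirichletFlux Ω ΓN j Φ v Dv t := by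
  simp only [dirichletFlux_eq, inner_smul_right, mul_left_comm _ c, integral_const_mul, mul_sub]

theorem dirichletFlux_sub (hq : 1 < q)
    (hΦ : MemLp Φ (ENNReal.ofReal q.conjExponent) (volume.restrict Ω))
    (hj : MemLp j (ENNReal.ofReal q.conjExponent) ((surf Ω).restrict ΓN))
    (hv : IsTracedSobolev Ω q v Dv t) (hw : IsTracedSobolev Ω q w Dw s) :
    dirichletFlux Ω ΓN j Φ (fun x => v x - w x) (fun x => Dv x - Dw x) (fun x => t x - s x) =
      dirichletFlux Ω ΓN j Φ v Dv t - dirichletFlux Ω ΓN j Φ w Dw s := by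
  simp only [dirichletFlux_eq, inner_sub_right, mul_sub]
  rw [integral_sub (hv.integrable_inner_grad hq hΦ) (hw.integrable_inner_grad hq hΦ),
    integral_sub (hv.integrable_mul_trace hq hj) (hw.integrable_mul_trace hq hj)]
  ring

theorem IsTraceApprox.tendsto_dirichletFlux (hq : 1 < q)
    (hΦ : MemLp Φ (ENNReal.ofReal q.conjExponent) (volume.restrict Ω))
    (hj : MemLp j (ENNReal.ofReal q.conjExponent) ((surf Ω).restrict ΓN))
    {f : ℕ → Eu d → ℝ} (hf : IsTraceApprox Ω q v Dv t f) :
    Tendsto (fun n => dirichletFlux Ω ΓN j Φ (f n) (gradient (f n)) (f n)) atTop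
      (𝓝 (dirichletFlux Ω ΓN j Φ v Dv t)) := by
  have := holderConjugate_ofReal_conjExponent hq
  simp only [dirichletFlux_eq]
  exact (hf.grad.tendsto_integral_bilin (innerSL ℝ) hΦ).sub
    ((hf.boundary.mono_measure Measure.restrict_le_self).tendsto_integral_bilin (.mul ℝ ℝ) hj)

/-- `Φ ∈ L^{q'}(Ω)` satisfies `Φ · ν ≤ 0` on `Γ_D`, given the flux `j ∈ L^{q'}(Γ_N)` through `Γ_N`.
The integrability is part of the notion: it makes the flux of `Φ` linear and continuous on
`W^{1,q}(Ω)`. -/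
structure IsOutgoing (Ω ΓD ΓN : Set (Eu d)) (q : ℝ) (j : Eu d → ℝ) (Φ : Eu d → Eu d) : Prop where
  memLp : MemLp Φ (ENNReal.ofReal q.conjExponent) (volume.restrict Ω)
  memLp_inflow : MemLp j (ENNReal.ofReal q.conjExponent) ((surf Ω).restrict ΓN)
  dirichletFlux_nonpos : ∀ {v Dv t}, IsTracedSobolev Ω q v Dv t →
    (∀ᵐ x ∂(surf Ω).restrict ΓD, 0 ≤ t x) → dirichletFlux Ω ΓN j Φ v Dv t ≤ 0

theorem IsOutgoing.dirichletFlux_le (hΩ : Bornology.IsBounded Ω) (hq : 1 < q)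
    (hΦ : IsOutgoing Ω ΓD ΓN q j Φ) (hv : IsTracedSobolev Ω q v Dv t)
    (hw : IsTracedSobolev Ω q w Dw s) (hts : ∀ᵐ x ∂(surf Ω).restrict ΓD, t x ≤ s x) :
    dirichletFlux Ω ΓN j Φ w Dw s ≤ dirichletFlux Ω ΓN j Φ v Dv t := by
  have hle := hΦ.dirichletFlux_nonpos (hw.sub hΩ hq.le hv) (hts.mono fun _ => sub_nonneg.2)
  rwa [dirichletFlux_sub hq hΦ.memLp hΦ.memLp_inflow hw hv, sub_nonpos] at hle

theorem IsOutgoing.dirichletFlux_eq_zero_of_abs_le (hΩ : Bornology.IsBounded Ω) (hq : 1 < q)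
    (hΦ : IsOutgoing Ω ΓD ΓN q j Φ) (hw : IsTracedSobolev Ω q w Dw s)
    (hw₀ : dirichletFlux Ω ΓN j Φ w Dw s = 0) (hv : IsTracedSobolev Ω q v Dv t) {M : ℝ}
    (hts : ∀ᵐ x ∂(surf Ω).restrict ΓD, |t x| ≤ M * s x) :
    dirichletFlux Ω ΓN j Φ v Dv t = 0 := by
  have hzero (c : ℝ) : dirichletFlux Ω ΓN j Φ (fun x => c * w x) (fun x => c • Dw x)
      (fun x => c * s x) = 0 := by
    rw [dirichletFlux_const_mul, hw₀, mul_zero]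
  refine le_antisymm ((hΦ.dirichletFlux_le hΩ hq (hw.const_mul hΩ hq.le (-M)) hv ?_).trans_eq
    (hzero _)) ((hzero M).ge.trans (hΦ.dirichletFlux_le hΩ hq hv (hw.const_mul hΩ hq.le M) ?_))
  · filter_upwards [hts] with x hx
    linarith [neg_abs_le (t x)]
  · filter_upwards [hts] with x hx using (le_abs_self _).trans hx

theorem IsOutgoing.dirichletFlux_smooth_mul_eq_zero (hΩ : Bornology.IsBounded Ω) (hq : 1 < q)
    (hΦ : IsOutgoing Ω ΓD ΓN q j Φ) (hw : IsTracedSobolev Ω q w Dw s)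
    (hw₀ : dirichletFlux Ω ΓN j Φ w Dw s = 0) (hv : IsTracedSobolev Ω q v Dv t)
    (hts : ∀ᵐ x ∂(surf Ω).restrict ΓD, |t x| ≤ s x) {φ : Eu d → ℝ} (hφ : ContDiff ℝ ∞ φ) :
    dirichletFlux Ω ΓN j Φ (fun x => φ x * v x) (fun x => φ x • Dv x + v x • gradient φ x)
      (fun x => φ x * t x) = 0 := by
  obtain ⟨M, hM⟩ := hΩ.isCompact_closure.exists_bound_of_continuousOn hφ.continuous.continuousOn
  refine hΦ.dirichletFlux_eq_zero_of_abs_le hΩ hq hw hw₀ (hv.smooth_mul hΩ hq.le hφ) (M := M) ?_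
  filter_upwards [hts, ae_restrict_of_ae ae_surf_mem_closure] with x hx hxΩ
  rw [abs_mul]
  exact mul_le_mul (hM x hxΩ) hx (abs_nonneg _) ((norm_nonneg _).trans (hM x hxΩ))

theorem IsOutgoing.fluxProductVanishes (hΩ : Bornology.IsBounded Ω) (hq : 1 < q)
    (hΦ : IsOutgoing Ω ΓD ΓN q j Φ) (hw : IsTracedSobolev Ω q w Dw s)
    (hs : ∀ᵐ x ∂(surf Ω).restrict ΓD, 0 ≤ s x) (hw₀ : dirichletFlux Ω ΓN j Φ w Dw s = 0) :
    FluxProductVanishes Ω ΓN j Φ w Dw s := fun _ hφ =>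
  hΦ.dirichletFlux_smooth_mul_eq_zero hΩ hq hw hw₀ hw (hs.mono fun _ hx => (abs_of_nonneg hx).le) hφ

theorem locallyIntegrableOn_of_integrable_mul_contDiff {E : Type*} [NormedAddCommGroup E]
    [NormedSpace ℝ E] [FiniteDimensional ℝ E] [MeasurableSpace E] [BorelSpace E] {μ : Measure E}
    {U : Set E} (hU : IsOpen U) {k : E → ℝ}
    (hk : ∀ φ : E → ℝ, ContDiff ℝ ∞ φ → HasCompactSupport φ → tsupport φ ⊆ U →
      Integrable (fun x => k x * φ x) μ) : LocallyIntegrableOn k U μ := by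
  intro x hx
  obtain ⟨r, hr, hrU⟩ := Metric.nhds_basis_closedBall.mem_iff.1 (hU.mem_nhds hx)
  let χ : ContDiffBump x := ⟨r / 2, r, half_pos hr, half_lt_self hr⟩
  have hkχ := hk χ χ.contDiff χ.hasCompactSupport (χ.tsupport_eq.subset.trans hrU)
  refine ⟨_, mem_nhdsWithin_of_mem_nhds (Metric.closedBall_mem_nhds x (half_pos hr)),
    hkχ.integrableOn.congr_fun (fun y hy => ?_) Metric.isClosed_closedBall.measurableSet⟩
  simp [χ.one_of_mem_closedBall hy]

theorem lipschitzWith_arctan : LipschitzWith 1 Real.arctan := by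
  refine lipschitzWith_of_nnnorm_deriv_le Real.differentiable_arctan fun x => ?_
  rw [Real.deriv_arctan, ← NNReal.coe_le_coe, coe_nnnorm, Real.norm_of_nonneg (by positivity)]
  exact div_le_one_of_le₀ (le_add_of_nonneg_right (sq_nonneg x)) (by positivity)

theorem FluxIsFunction.dirichletFlux_mul_comp_eq (hΩ : Bornology.IsBounded Ω) (hq : 1 < q)
    (hΦ : MemLp Φ (ENNReal.ofReal q.conjExponent) (volume.restrict Ω))
    (hj : MemLp j (ENNReal.ofReal q.conjExponent) ((surf Ω).restrict ΓN))
    (hh : FluxIsFunction Ω ΓD ΓN j Φ h) (hw : IsTracedSobolev Ω q w Dw s) {θ : ℝ → ℝ} {K : NNReal}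
    {C : ℝ} (hθ : ContDiff ℝ ∞ θ) (hθK : LipschitzWith K θ) (hθ₀ : θ 0 = 0)
    (hθC : ∀ a, ‖θ a‖ ≤ C) {φ : Eu d → ℝ} (hφ : ContDiff ℝ ∞ φ) (hφc : HasCompactSupport φ)
    (hφD : tsupport φ ∩ frontier Ω ⊆ ΓD) :
    dirichletFlux Ω ΓN j Φ (fun x => φ x * θ (w x))
      (fun x => φ x • (deriv θ (w x) • Dw x) + θ (w x) • gradient φ x) (fun x => φ x * θ (s x)) =
      ∫ x in ΓD, h x * φ x * θ (s x) ∂surf Ω := by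
  obtain ⟨f, hf, hinterior, hboundary⟩ := hw.exists_approx_tendsto_ae (by linarith)
  have hflux := ((hf.comp_lipschitzWith hq.le hinterior hθ hθK hθ₀).smooth_mul hΩ hq.le
    hφ).tendsto_dirichletFlux hq hΦ hj
  have hhφ := (hh φ hφ hφc hφD).1
  have hintegral : Tendsto (fun n => ∫ x in ΓD, h x * φ x * θ (f n x) ∂surf Ω) atTop
      (𝓝 (∫ x in ΓD, h x * φ x * θ (s x) ∂surf Ω)) := by
    refine tendsto_integral_of_dominated_convergence (fun x => ‖h x * φ x‖ * C) (fun n => ?_)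
      (hhφ.norm.mul_const C) (fun n => .of_forall fun x => ?_) ?_
    · exact hhφ.aestronglyMeasurable.mul
        (hθ.continuous.comp (hf.contDiff n).continuous).aestronglyMeasurable
    · rw [norm_mul]
      gcongr
      exact hθC _
    · filter_upwards [ae_restrict_of_ae hboundary] with x hx
      exact ((hθ.continuous.tendsto _).comp hx).const_mul _
  refine tendsto_nhds_unique hflux (hintegral.congr fun n => ?_)
  simp only [mul_assoc]
  exact (hh _ (hφ.mul (hθ.comp (hf.contDiff n))) hφc.mul_right
    ((inter_subset_inter_left _ tsupport_mul_subset_left).trans hφD)).2.symm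

theorem IsOutgoing.ae_mul_eq_zero (hΩ : Bornology.IsBounded Ω)
    (hΓD : ∃ U, IsOpen U ∧ ΓD = U ∩ frontier Ω) (hq : 1 < q) (hΦ : IsOutgoing Ω ΓD ΓN q j Φ)
    (hw : IsTracedSobolev Ω q w Dw s) (hs : ∀ᵐ x ∂(surf Ω).restrict ΓD, 0 ≤ s x)
    (hw₀ : dirichletFlux Ω ΓN j Φ w Dw s = 0) (hh : FluxIsFunction Ω ΓD ΓN j Φ h) :
    ∀ᵐ x ∂(surf Ω).restrict ΓD, s x * h x = 0 := by
  obtain ⟨U, hU, hUD⟩ := hΓD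
  have hφD {φ : Eu d → ℝ} (hφ : tsupport φ ⊆ U) : tsupport φ ∩ frontier Ω ⊆ ΓD :=
    hUD ▸ inter_subset_inter_left _ hφ
  have hbound (a : ℝ) : ‖Real.arctan a‖ ≤ Real.pi / 2 :=
    abs_le.2 ⟨(Real.neg_pi_div_two_lt_arctan a).le, (Real.arctan_lt_pi_div_two a).le⟩
  have hlip := lipschitzWith_arctan
  have harctan : ∀ᵐ x ∂(surf Ω).restrict ΓD, |Real.arctan (s x)| ≤ s x :=
    hs.mono fun x hx => by simpa [abs_of_nonneg hx] using hlip.norm_sub_le (s x) 0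
  have hlocal : LocallyIntegrableOn (fun x => Real.arctan (s x) * h x) U
      ((surf Ω).restrict ΓD) := by
    refine locallyIntegrableOn_of_integrable_mul_contDiff hU fun φ hφ hφc hφU => ?_
    simp only [mul_assoc]
    exact (hh φ hφ hφc (hφD hφU)).1.bdd_mul (Real.continuous_arctan.comp_aestronglyMeasurable
      hw.memLp_trace.aestronglyMeasurable).restrict (.of_forall fun x => hbound _)
  have htested : ∀ φ : Eu d → ℝ, ContDiff ℝ ∞ φ → HasCompactSupport φ → tsupport φ ⊆ U →
      ∫ x in ΓD, φ x • (Real.arctan (s x) * h x) ∂surf Ω = 0 := by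
    intro φ hφ hφc hφU
    have hflux := hh.dirichletFlux_mul_comp_eq hΩ hq hΦ.memLp hΦ.memLp_inflow hw
      Real.contDiff_arctan hlip Real.arctan_zero hbound hφ hφc (hφD hφU)
    rw [hΦ.dirichletFlux_smooth_mul_eq_zero hΩ hq hw hw₀
      (hw.comp_lipschitzWith hq.le Real.contDiff_arctan hlip Real.arctan_zero) harctan hφ] at hflux
    simpa only [smul_eq_mul, mul_comm, mul_left_comm, mul_assoc] using hflux.symm
  have hmeas : MeasurableSet ΓD := hUD ▸ hU.measurableSet.inter isClosed_frontier.measurableSet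
  filter_upwards [hU.ae_eq_zero_of_integral_contDiff_smul_eq_zero hlocal htested,
    ae_restrict_mem hmeas] with x hx hxD
  have hxU : x ∈ U := (hUD.subset hxD).1
  simpa [Real.arctan_eq_zero_iff] using hx hxU

theorem IsOutgoing.cross_dirichletFlux_eq_zero (hΩ : Bornology.IsBounded Ω) (hq : 1 < q)
    (hΦ : IsOutgoing Ω ΓD ΓN q j Φ) (hΨ : IsOutgoing Ω ΓD ΓN q j Ψ)
    {ψ : Eu d → ℝ} {Dψ : Eu d → Eu d} {r : Eu d → ℝ} (hψ : IsTracedSobolev Ω q ψ Dψ r)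
    (hv : IsTracedSobolev Ω q v Dv t) (hw : IsTracedSobolev Ω q w Dw s)
    (htr : ∀ᵐ x ∂(surf Ω).restrict ΓD, t x ≤ r x) (hsr : ∀ᵐ x ∂(surf Ω).restrict ΓD, s x ≤ r x)
    (hΦv : dirichletFlux Ω ΓN j Φ (fun x => ψ x - v x) (fun x => Dψ x - Dv x)
      (fun x => r x - t x) = 0)
    (hΨw : dirichletFlux Ω ΓN j Ψ (fun x => ψ x - w x) (fun x => Dψ x - Dw x)
      (fun x => r x - s x) = 0)
    (hmono : 0 ≤ ∫ x in Ω, ⟪Φ x - Ψ x, Dv x - Dw x⟫) :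
    dirichletFlux Ω ΓN j Φ (fun x => ψ x - w x) (fun x => Dψ x - Dw x) (fun x => r x - s x) = 0 ∧
      dirichletFlux Ω ΓN j Ψ (fun x => ψ x - v x) (fun x => Dψ x - Dv x) (fun x => r x - t x) = 0 ∧
      ∫ x in Ω, ⟪Φ x - Ψ x, Dv x - Dw x⟫ = 0 := by
  have hΦw := hΦ.dirichletFlux_le hΩ hq hw hψ hsr
  have hΨv := hΨ.dirichletFlux_le hΩ hq hv hψ htr
  have hidentity := dirichletFlux_sub_dirichletFlux (ΓN := ΓN) (j := j) hq hΦ.memLp hΨ.memLp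
    (hv.sub hΩ hq.le hw)
  rw [dirichletFlux_sub hq hΦ.memLp hΦ.memLp_inflow hv hw,
    dirichletFlux_sub hq hΨ.memLp hΨ.memLp_inflow hv hw] at hidentity
  rw [dirichletFlux_sub hq hΦ.memLp hΦ.memLp_inflow hψ hv] at hΦv
  rw [dirichletFlux_sub hq hΨ.memLp hΨ.memLp_inflow hψ hw] at hΨw
  rw [dirichletFlux_sub hq hΦ.memLp hΦ.memLp_inflow hψ hw,
    dirichletFlux_sub hq hΨ.memLp hΨ.memLp_inflow hψ hv]
  refine ⟨?_, ?_, ?_⟩ <;> linarith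

end Flux

section Monotonicity

variable {E : Type*} [NormedAddCommGroup E] [InnerProductSpace ℝ E] [CompleteSpace E]
  {F : E → ℝ} {p r : E} {g : ℝ → ℝ} {m η a b : ℝ}

theorem sub_le_inner_gradient (hF : ConvexOn ℝ univ F) (hp : DifferentiableAt ℝ F p) (r : E) :
    F p - F r ≤ ⟪gradient F p, p - r⟫ := by
  have hline : ConvexOn ℝ univ (F ∘ AffineMap.lineMap (k := ℝ) p r) := by
    simpa using hF.comp_affineMap (AffineMap.lineMap (k := ℝ) p r)
  have hderiv : HasDerivAt (F ∘ AffineMap.lineMap (k := ℝ) p r) (fderiv ℝ F p (r - p)) 0 := by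
    have hp₀ : HasFDerivAt F (fderiv ℝ F p) (AffineMap.lineMap (k := ℝ) p r 0) := by
      simpa using hp.hasFDerivAt
    exact hp₀.comp_hasDerivAt 0 AffineMap.hasDerivAt_lineMap
  have hslope := hline.le_slope_of_hasDerivAt (mem_univ 0) (mem_univ 1) zero_lt_one hderiv
  rw [← inner_gradient_left, ← neg_sub p r, inner_neg_right] at hslope
  simp only [slope_def_field, Function.comp_apply, AffineMap.lineMap_apply_one,
    AffineMap.lineMap_apply_zero, sub_zero, div_one] at hslope
  linarith

theorem sub_lt_inner_gradient (hF : StrictConvexOn ℝ univ F) (hp : DifferentiableAt ℝ F p)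
    (hpr : p ≠ r) : F p - F r < ⟪gradient F p, p - r⟫ := by
  have hle := sub_le_inner_gradient hF.convexOn hp (midpoint ℝ p r)
  have hlt : F (midpoint ℝ p r) < (F p + F r) / 2 := by
    have hhalf := hF.2 (mem_univ p) (mem_univ r) hpr one_half_pos one_half_pos (add_halves 1)
    rw [← smul_add, one_div, ← invOf_eq_inv, ← midpoint_eq_smul_add] at hhalf
    simp only [invOf_eq_inv, smul_eq_mul] at hhalf
    linarith
  rw [left_sub_midpoint, inner_smul_right, invOf_eq_inv] at hle
  linarith

theorem sub_mul_sub_le_inner_gradient (hF : ConvexOn ℝ univ F) (hp : DifferentiableAt ℝ F p)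
    (hr : DifferentiableAt ℝ F r) (hm : 0 ≤ m) (hη : 0 ≤ η) :
    (m - η) * (F p - F r) ≤ ⟪m • gradient F p - η • gradient F r, p - r⟫ := by
  have hpr := mul_le_mul_of_nonneg_left (sub_le_inner_gradient hF hp r) hm
  have hrp := mul_le_mul_of_nonneg_left (sub_le_inner_gradient hF hr p) hη
  rw [← neg_sub p r, inner_neg_right] at hrp
  rw [inner_sub_left, real_inner_smul_left, real_inner_smul_left]
  linarith

theorem sub_mul_sub_lt_inner_gradient (hF : StrictConvexOn ℝ univ F) (hp : DifferentiableAt ℝ F p)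
    (hr : DifferentiableAt ℝ F r) (hm : 0 < m) (hη : 0 ≤ η) (hpr : p ≠ r) :
    (m - η) * (F p - F r) < ⟪m • gradient F p - η • gradient F r, p - r⟫ := by
  have hlt := mul_lt_mul_of_pos_left (sub_lt_inner_gradient hF hp hpr) hm
  have hrp := mul_le_mul_of_nonneg_left (sub_le_inner_gradient hF.convexOn hr p) hη
  rw [← neg_sub p r, inner_neg_right] at hrp
  rw [inner_sub_left, real_inner_smul_left, real_inner_smul_left]
  linarith

/-- The pointwise Hamilton-Jacobi relation of a weak solution, between the density `m` and the value
`a` of the Hamiltonian. -/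
structure IsHJPair (g : ℝ → ℝ) (m a : ℝ) : Prop where
  nonneg : 0 ≤ m
  le : a ≤ g m
  eq_of_pos : 0 < m → a = g m

theorem IsHJPair.lt_of_lt (hg : StrictMonoOn g (Ici 0)) (hm : IsHJPair g m a)
    (hη : IsHJPair g η b) (hmη : m < η) : a < b := by
  rw [hη.eq_of_pos (hm.nonneg.trans_lt hmη)]
  exact hm.le.trans_lt (hg hm.nonneg hη.nonneg hmη)

theorem IsHJPair.sub_mul_sub_pos (hg : StrictMonoOn g (Ici 0)) (hm : IsHJPair g m a)
    (hη : IsHJPair g η b) (hmη : m ≠ η) : 0 < (m - η) * (a - b) := by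
  rcases hmη.lt_or_gt with hlt | hgt
  · exact mul_pos_of_neg_of_neg (sub_neg.2 hlt) (sub_neg.2 (hm.lt_of_lt hg hη hlt))
  · exact mul_pos (sub_pos.2 hgt) (sub_pos.2 (hη.lt_of_lt hg hm hgt))

theorem IsHJPair.inner_gradient_nonneg (hg : StrictMonoOn g (Ici 0)) (hF : ConvexOn ℝ univ F)
    (hp : DifferentiableAt ℝ F p) (hr : DifferentiableAt ℝ F r) (hm : IsHJPair g m (F p))
    (hη : IsHJPair g η (F r)) : 0 ≤ ⟪m • gradient F p - η • gradient F r, p - r⟫ := by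
  refine le_trans ?_ (sub_mul_sub_le_inner_gradient hF hp hr hm.nonneg hη.nonneg)
  rcases eq_or_ne m η with rfl | hmη
  · simp
  · exact (hm.sub_mul_sub_pos hg hη hmη).le

theorem IsHJPair.eq_and_eq_of_inner_gradient_eq_zero (hg : StrictMonoOn g (Ici 0))
    (hF : StrictConvexOn ℝ univ F) (hp : DifferentiableAt ℝ F p) (hr : DifferentiableAt ℝ F r)
    (hm : IsHJPair g m (F p)) (hη : IsHJPair g η (F r))
    (hzero : ⟪m • gradient F p - η • gradient F r, p - r⟫ = 0) : η = m ∧ (0 < m → p = r) := by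
  have hle := sub_mul_sub_le_inner_gradient hF.convexOn hp hr hm.nonneg hη.nonneg
  have hmη : m = η := by
    by_contra hne
    exact (hle.trans_eq hzero).not_gt (hm.sub_mul_sub_pos hg hη hne)
  refine ⟨hmη.symm, fun hpos => ?_⟩
  by_contra hpr
  have hlt := sub_mul_sub_lt_inner_gradient hF hp hr hpos hη.nonneg hpr
  rw [hzero, hmη, sub_self, zero_mul] at hlt
  exact hlt.false

theorem IsPseudoInverse.strictMonoOn {G : ℝ → ℝ} (hg : IsPseudoInverse g G)
    (hG : ConvexOn ℝ univ G) (hG' : Differentiable ℝ G) : StrictMonoOn g (Ici 0) := by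
  intro μ hμ ν hν hμν
  by_contra! hle
  have hderiv := hG.monotoneOn_deriv (fun z _ => hG' z) (mem_univ _) (mem_univ _) hle
  rw [(hg μ hμ).1, (hg ν hν).1] at hderiv
  exact hderiv.not_gt hμν

end Monotonicity

section Integrability

theorem holderTriple_conjExponent_mul {α β : ℝ} (hα : 1 < α) (hβ : 1 < β) :
    Real.HolderTriple α.conjExponent (α * β / (β - 1)) (α * β).conjExponent := by
  have hα' : 0 < α - 1 := sub_pos.2 hα
  have hβ' : 0 < β - 1 := sub_pos.2 hβ
  have hαβ' : 0 < α * β - 1 := sub_pos.2 (one_lt_mul_of_lt_of_le hα hβ.le)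
  refine ⟨?_, div_pos (by linarith) hα', div_pos (by linarith) hβ'⟩
  simp only [Real.conjExponent]
  field_simp
  ring

theorem memLp_conjExponent_mul_of_norm_le {X E : Type*} [MeasurableSpace X] {μ : Measure X}
    [IsFiniteMeasure μ] [NormedAddCommGroup E] {α β C : ℝ} (hα : 1 < α) (hβ : 1 < β)
    {m : X → ℝ} {V Φ : X → E} (hm : MemLp m (ENNReal.ofReal α.conjExponent) μ)
    (hV : MemLp V (ENNReal.ofReal (α * β)) μ) (hΦ : AEStronglyMeasurable Φ μ)
    (hΦC : ∀ᵐ x ∂μ, ‖Φ x‖ ≤ C * (|m x| * (‖V x‖ ^ (β - 1) + 1))) :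
    MemLp Φ (ENNReal.ofReal (α * β).conjExponent) μ := by
  have hβ' : 0 < β - 1 := sub_pos.2 hβ
  have hpow := hV.norm_rpow_div (ENNReal.ofReal (β - 1))
  rw [ENNReal.toReal_ofReal hβ'.le, ← ENNReal.ofReal_div_of_pos hβ'] at hpow
  have := (holderTriple_conjExponent_mul hα hβ).ennrealOfReal
  refine ((hpow.add (memLp_const (1 : ℝ))).mul' hm).of_le_mul (c := C) hΦ (hΦC.mono fun x hx => ?_)
  rwa [norm_mul, Pi.add_apply, Real.norm_eq_abs, Real.norm_of_nonneg (by positivity)]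

theorem conjExponent_le_conjExponent {p q : ℝ} (hp : 1 < p) (hpq : p ≤ q) :
    q.conjExponent ≤ p.conjExponent := by
  rw [Real.conjExponent, Real.conjExponent, div_le_div_iff₀ (by linarith) (by linarith)]
  linarith

end Integrability

section SurfaceMeasure

theorem euclideanHausdorffMeasure_image_lt_top {X Y : Type*} [EMetricSpace X] [EMetricSpace Y]
    [MeasurableSpace X] [BorelSpace X] [MeasurableSpace Y] [BorelSpace Y] {K : NNReal} {f : X → Y}
    {s : Set X} (hf : LipschitzOnWith K f s) {k : ℕ} (hs : μHE[k] s < ⊤) : μHE[k] (f '' s) < ⊤ := by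
  rw [Measure.euclideanHausdorffMeasure_def, Measure.smul_apply, ENNReal.smul_def, smul_eq_mul]
    at hs ⊢
  calc _ ≤ _ * ((K : ENNReal) ^ (k : ℝ) * μH[k] s) := by
        gcongr; exact hf.hausdorffMeasure_image_le (by positivity)
    _ = (K : ENNReal) ^ (k : ℝ) * (_ * μH[k] s) := by ring
    _ < ⊤ := ENNReal.mul_lt_top (ENNReal.rpow_lt_top_of_nonneg (by positivity) (by simp)) hs

theorem exists_mem_nhds_euclideanHausdorffMeasure_image_lt_top
    {V E : Type*} [NormedAddCommGroup V] [InnerProductSpace ℝ V] [FiniteDimensional ℝ V]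
    [MeasurableSpace V] [BorelSpace V] [NormedAddCommGroup E] [NormedSpace ℝ E]
    [MeasurableSpace E] [BorelSpace E] {f : V → E} {z : V} (hf : ContDiffAt ℝ 1 f z) :
    ∃ s ∈ 𝓝 z, μHE[Module.finrank ℝ V] (f '' s) < ⊤ := by
  obtain ⟨K, t, ht, hLip⟩ := hf.exists_lipschitzOnWith
  refine ⟨t ∩ Metric.ball z 1, inter_mem ht (Metric.ball_mem_nhds _ one_pos),
    euclideanHausdorffMeasure_image_lt_top (hLip.mono inter_subset_left) ?_⟩
  rw [InnerProductSpace.euclideanHausdorffMeasure_eq_volume]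
  exact (measure_mono inter_subset_right).trans_lt measure_ball_lt_top

theorem frontier_inter_subset_of_forall_mem_iff_lt {X : Type*} [TopologicalSpace X] {s U : Set X}
    {a b : X → ℝ} (ha : Continuous a) (hb : Continuous b) (hU : IsOpen U)
    (h : ∀ y ∈ U, (y ∈ s ↔ a y < b y)) : frontier s ∩ U ⊆ {y | a y = b y} := by
  have hs : s ∩ U = {y | a y < b y} ∩ U := ext fun y => and_congr_left (h y)
  rw [← frontier_inter_open_inter hU, hs, frontier_inter_open_inter hU]
  exact inter_subset_left.trans (frontier_lt_subset_eq ha hb)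

theorem starProjection_orthogonal_add_inner_smul {E : Type*} [NormedAddCommGroup E]
    [InnerProductSpace ℝ E] {e : E} (he : ‖e‖ = 1) (y : E) :
    (ℝ ∙ e)ᗮ.starProjection y + ⟪e, y⟫ • e = y := by
  rw [← Submodule.starProjection_unit_singleton ℝ he, add_comm,
    Submodule.starProjection_add_starProjection_orthogonal]

theorem HasC1Boundary.exists_mem_nhds_frontier (hd : 1 ≤ d) {Ω : Set (Eu d)}
    (hΩ : HasC1Boundary Ω) {x : Eu d} (hx : x ∈ frontier Ω) :
    ∃ s ∈ 𝓝[frontier Ω] x, μHE[d - 1] s < ⊤ := by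
  obtain ⟨e, he, h, hh, r, hr, hball⟩ := hΩ x hx
  have : Fact (Module.finrank ℝ (Eu d) = d - 1 + 1) := ⟨by simp; omega⟩
  have hfinrank : Module.finrank ℝ (ℝ ∙ e)ᗮ = d - 1 :=
    Submodule.finrank_orthogonal_span_singleton (norm_ne_zero_iff.1 (by simp [he]))
  have hgraph : ContDiff ℝ 1 fun z : (ℝ ∙ e)ᗮ => (z : Eu d) + h z • e :=
    (ℝ ∙ e)ᗮ.subtypeL.contDiff.add (hh.fun_smul contDiff_const)
  set P := (ℝ ∙ e)ᗮ.orthogonalProjectionOnto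
  obtain ⟨s, hs, hfin⟩ :=
    exists_mem_nhds_euclideanHausdorffMeasure_image_lt_top (hgraph.contDiffAt (x := P x))
  rw [hfinrank] at hfin
  refine ⟨_, ?_, hfin⟩
  filter_upwards [self_mem_nhdsWithin, mem_nhdsWithin_of_mem_nhds (Metric.ball_mem_nhds x hr),
    mem_nhdsWithin_of_mem_nhds (P.continuous.continuousAt.preimage_mem_nhds hs)] with y hyf hyb hys
  have hy : ⟪e, y⟫ = h (P y) := frontier_inter_subset_of_forall_mem_iff_lt
    (continuous_const.inner continuous_id) (hh.continuous.comp P.continuous) Metric.isOpen_ball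
    hball ⟨hyf, hyb⟩
  refine ⟨P y, hys, ?_⟩
  beta_reduce
  rw [← hy]
  exact starProjection_orthogonal_add_inner_smul he y

theorem IsC1Domain.isFiniteMeasure_surf (hd : 1 ≤ d) {Ω : Set (Eu d)} (hΩ : IsC1Domain Ω) :
    IsFiniteMeasure (surf Ω) := by
  have hcompact : IsCompact (frontier Ω) :=
    hΩ.isBounded.isCompact_closure.of_isClosed_subset isClosed_frontier frontier_subset_closure
  exact ⟨by simpa only [surf, Measure.restrict_apply_univ] using
    hcompact.measure_lt_top_of_nhdsWithin fun x hx => hΩ.c1.exists_mem_nhds_frontier hd hx⟩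

end SurfaceMeasure

section Solution

variable {Ω ΓD ΓN : Set (Eu d)} {α β : ℝ} {H : Eu d → Eu d → ℝ} {g : ℝ → ℝ} {j ψ m u : Eu d → ℝ}
  {Dψ Du : Eu d → Eu d} {tψ tu : Eu d → ℝ}

theorem IsHamiltonian.differentiable (hH : IsHamiltonian Ω H β) (hΩ : IsOpen Ω) {x : Eu d}
    (hx : x ∈ Ω) : Differentiable ℝ (H x) := fun p => by
  have hnhds : closure Ω ×ˢ univ ∈ 𝓝 (x, p) :=
    mem_of_superset ((hΩ.prod isOpen_univ).mem_nhds ⟨hx, mem_univ p⟩)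
      (prod_mono_left subset_closure)
  have hjoint : DifferentiableAt ℝ (fun z : Eu d × Eu d => H z.1 z.2) (x, p) :=
    (hH.c2.contDiffAt hnhds).differentiableAt two_ne_zero
  exact hjoint.comp p (differentiableAt_const x |>.prodMk differentiableAt_id)

theorem IsHamiltonian.exists_norm_gradient_le (hH : IsHamiltonian Ω H β) :
    ∃ C, ∀ x ∈ Ω, ∀ p, ‖gradient (H x) p‖ ≤ C * (‖p‖ ^ (β - 1) + 1) :=
  hH.growth.imp fun _ hC x hx p => (hC.2 x hx p).2.2.2

theorem IsInflow.memLp_conjExponent [IsFiniteMeasure (surf Ω)] (hj : IsInflow Ω ΓN j β)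
    (hβ : 1 < β) {q : ℝ} (hq : β ≤ q) :
    MemLp j (ENNReal.ofReal q.conjExponent) ((surf Ω).restrict ΓN) :=
  hj.memLp.mono_exponent (ENNReal.ofReal_le_ofReal (conjExponent_le_conjExponent hβ hq))

variable (hu : IsWeakSolution Ω ΓD ΓN α β H g j ψ Dψ tψ m u Du tu)
include hu

theorem IsWeakSolution.isTracedSobolev (hq : 1 < α * β) : IsTracedSobolev Ω (α * β) u Du tu :=
  (isTracedSobolev_iff hq).2 ⟨hu.sobolev_u, hu.trace_u⟩

theorem IsWeakSolution.isHJPair :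
    ∀ᵐ x ∂volume.restrict Ω, IsHJPair g (m x) (H x (Du x)) := by
  filter_upwards [hu.nonneg, hu.hj_le, hu.hj_eq] with x hnonneg hle heq using ⟨hnonneg, hle, heq⟩

theorem IsWeakSolution.memLp_flow (hΩ : IsOpen Ω) (hΩb : Bornology.IsBounded Ω) (hα : 1 < α)
    (hβ : 1 < β)
    (hH : ∃ C, ∀ x ∈ Ω, ∀ p, ‖gradient (H x) p‖ ≤ C * (‖p‖ ^ (β - 1) + 1)) :
    MemLp (flow H m Du) (ENNReal.ofReal (α * β).conjExponent) (volume.restrict Ω) := by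
  obtain ⟨C, hC⟩ := hH
  have : IsFiniteMeasure (volume.restrict Ω) := isFiniteMeasure_restrict.2 hΩb.measure_lt_top.ne
  refine memLp_conjExponent_mul_of_norm_le (C := C) hα hβ hu.memLp_m hu.sobolev_u.memLp_grad
    hu.flow_integrable.aestronglyMeasurable ?_
  filter_upwards [ae_restrict_mem hΩ.measurableSet] with x hx
  rw [flow, norm_smul, Real.norm_eq_abs, mul_left_comm]
  exact mul_le_mul_of_nonneg_left (hC x hx _) (abs_nonneg _)

theorem IsWeakSolution.isOutgoing (hΩ : IsOpen Ω) (hΩb : Bornology.IsBounded Ω) (hα : 1 < α)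
    (hβ : 1 < β) (hH : ∃ C, ∀ x ∈ Ω, ∀ p, ‖gradient (H x) p‖ ≤ C * (‖p‖ ^ (β - 1) + 1))
    (hj : MemLp j (ENNReal.ofReal (α * β).conjExponent) ((surf Ω).restrict ΓN)) :
    IsOutgoing Ω ΓD ΓN (α * β) j (flow H m Du) where
  memLp := hu.memLp_flow hΩ hΩb hα hβ hH
  memLp_inflow := hj
  dirichletFlux_nonpos hv ht :=
    have hv' := (isTracedSobolev_iff (one_lt_mul_of_lt_of_le hα hβ.le)).1 hv
    hu.exit _ _ _ hv'.1 hv'.2 ht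

theorem IsWeakSolution.dirichletFlux_eq_zero :
    dirichletFlux Ω ΓN j (flow H m Du) (fun x => ψ x - u x) (fun x => Dψ x - Du x)
      (fun x => tψ x - tu x) = 0 := by
  simpa [gradient_fun_const] using hu.contact (fun _ => 1) contDiff_const

end Solution

section Uniqueness

variable {Ω ΓD ΓN : Set (Eu d)} {α β : ℝ} {H : Eu d → Eu d → ℝ} {g : ℝ → ℝ} {j ψ : Eu d → ℝ}
  {Dψ : Eu d → Eu d} {tψ : Eu d → ℝ} {m u η ξ : Eu d → ℝ} {Du Dξ : Eu d → Eu d}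
  {tu tξ : Eu d → ℝ}

theorem IsWeakSolution.inner_flow_sub_nonneg
    (hu : IsWeakSolution Ω ΓD ΓN α β H g j ψ Dψ tψ m u Du tu)
    (hξ : IsWeakSolution Ω ΓD ΓN α β H g j ψ Dψ tψ η ξ Dξ tξ) (hΩ : MeasurableSet Ω)
    (hg : StrictMonoOn g (Ici 0)) (hH : ∀ x ∈ Ω, Differentiable ℝ (H x))
    (hHc : ∀ x ∈ Ω, ConvexOn ℝ univ (H x)) :
    ∀ᵐ x ∂volume.restrict Ω, 0 ≤ ⟪flow H m Du x - flow H η Dξ x, Du x - Dξ x⟫ := by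
  filter_upwards [hu.isHJPair, hξ.isHJPair, ae_restrict_mem hΩ] with x hm hη hx
  exact hm.inner_gradient_nonneg hg (hHc x hx) (hH x hx _) (hH x hx _) hη

theorem IsWeakSolution.ae_eq_and_eq_of_inner_flow_sub_eq_zero
    (hu : IsWeakSolution Ω ΓD ΓN α β H g j ψ Dψ tψ m u Du tu)
    (hξ : IsWeakSolution Ω ΓD ΓN α β H g j ψ Dψ tψ η ξ Dξ tξ) (hΩ : MeasurableSet Ω)
    (hg : StrictMonoOn g (Ici 0)) (hH : ∀ x ∈ Ω, Differentiable ℝ (H x))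
    (hHc : ∀ x ∈ Ω, StrictConvexOn ℝ univ (H x))
    (hzero : ∀ᵐ x ∂volume.restrict Ω, ⟪flow H m Du x - flow H η Dξ x, Du x - Dξ x⟫ = 0) :
    ∀ᵐ x ∂volume.restrict Ω, η x = m x ∧ (0 < m x → Du x = Dξ x) := by
  filter_upwards [hu.isHJPair, hξ.isHJPair, ae_restrict_mem hΩ, hzero] with x hm hη hx hx₀
  exact hm.eq_and_eq_of_inner_gradient_eq_zero hg (hHc x hx) (hH x hx _) (hH x hx _) hη hx₀

end Uniqueness

end MixedMFG

end

theorem theorem2_general {d : ℕ} {Ω ΓD ΓN : Set (Eu d)} (hΩ : IsOpen Ω)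
    (hΩb : Bornology.IsBounded Ω) (hΓD : ∃ U, IsOpen U ∧ ΓD = U ∩ frontier Ω)
    {α β : ℝ} (hα : 1 < α) (hβ : 1 < β) {g : ℝ → ℝ} (hg : StrictMonoOn g (Ici 0))
    {H : Eu d → Eu d → ℝ} (hH : ∀ x ∈ Ω, Differentiable ℝ (H x))
    (hHc : ∀ x ∈ Ω, StrictConvexOn ℝ univ (H x))
    (hHg : ∃ C, ∀ x ∈ Ω, ∀ p, ‖gradient (H x) p‖ ≤ C * (‖p‖ ^ (β - 1) + 1))
    {j : Eu d → ℝ}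
    (hj : MemLp j (ENNReal.ofReal (α * β).conjExponent) ((surf Ω).restrict ΓN))
    {ψ : Eu d → ℝ} {Dψ : Eu d → Eu d} {tψ : Eu d → ℝ}
    (hψ : MemSobolev Ω (α * β) ψ Dψ) (htψ : HasTrace Ω (α * β) ψ Dψ tψ)
    {m u : Eu d → ℝ} {Du : Eu d → Eu d} {tu : Eu d → ℝ}
    (hu : IsWeakSolution Ω ΓD ΓN α β H g j ψ Dψ tψ m u Du tu)
    {η ξ : Eu d → ℝ} {Dξ : Eu d → Eu d} {tξ : Eu d → ℝ}
    (hξ : IsWeakSolution Ω ΓD ΓN α β H g j ψ Dψ tψ η ξ Dξ tξ) :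
    (FluxProductVanishes Ω ΓN j (flow H η Dξ)
        (fun x => ψ x - u x) (fun x => Dψ x - Du x) (fun x => tψ x - tu x) ∧
      FluxProductVanishes Ω ΓN j (flow H m Du)
        (fun x => ψ x - ξ x) (fun x => Dψ x - Dξ x) (fun x => tψ x - tξ x)) ∧
    ((∀ h : Eu d → ℝ, FluxIsFunction Ω ΓD ΓN j (flow H η Dξ) h →
        ∀ᵐ x ∂(surf Ω).restrict ΓD, (tψ x - tu x) * h x = 0) ∧
      (∀ h : Eu d → ℝ, FluxIsFunction Ω ΓD ΓN j (flow H m Du) h →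
        ∀ᵐ x ∂(surf Ω).restrict ΓD, (tψ x - tξ x) * h x = 0)) ∧
    (∀ᵐ x ∂volume.restrict Ω, η x = m x) ∧
    (∀ᵐ x ∂volume.restrict Ω, 0 < m x → Du x = Dξ x) := by
  have hq : 1 < α * β := one_lt_mul_of_lt_of_le hα hβ.le
  have hψS := (isTracedSobolev_iff hq).2 ⟨hψ, htψ⟩
  have huS := hu.isTracedSobolev hq
  have hξS := hξ.isTracedSobolev hq
  have hΦ := hu.isOutgoing hΩ hΩb hα hβ hHg hj
  have hΨ := hξ.isOutgoing hΩ hΩb hα hβ hHg hj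
  have hmono := hu.inner_flow_sub_nonneg hξ hΩ.measurableSet hg hH fun x hx => (hHc x hx).convexOn
  obtain ⟨hΦξ, hΨu, hintegral⟩ := hΦ.cross_dirichletFlux_eq_zero hΩb hq hΨ hψS huS hξS
    hu.le_exit_cost hξ.le_exit_cost hu.dirichletFlux_eq_zero hξ.dirichletFlux_eq_zero
    (integral_nonneg_of_ae hmono)
  have hzero := (integral_eq_zero_iff_of_nonneg_ae hmono
    ((huS.sub hΩb hq.le hξS).integrable_inner_grad hq (hΦ.memLp.sub hΨ.memLp))).1 hintegral
  have heq := hu.ae_eq_and_eq_of_inner_flow_sub_eq_zero hξ hΩ.measurableSet hg hH hHc hzero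
  have hψu := hψS.sub hΩb hq.le huS
  have hψξ := hψS.sub hΩb hq.le hξS
  have htu := hu.le_exit_cost.mono fun _ => sub_nonneg.2
  have htξ := hξ.le_exit_cost.mono fun _ => sub_nonneg.2
  exact ⟨⟨hΨ.fluxProductVanishes hΩb hq hψu htu hΨu, hΦ.fluxProductVanishes hΩb hq hψξ htξ hΦξ⟩,
    ⟨fun _ => hΨ.ae_mul_eq_zero hΩb hΓD hq hψu htu hΨu,
      fun _ => hΦ.ae_mul_eq_zero hΩb hΓD hq hψξ htξ hΦξ⟩,
    heq.mono fun _ => And.left, heq.mono fun _ => And.right⟩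

theorem theorem2 {d : ℕ} (hd : 1 ≤ d) {Ω ΓD ΓN : Set (Eu d)}
    (hΩ : IsC1Domain Ω) (hΓ : IsBoundaryPartition Ω ΓD ΓN)
    {α β : ℝ} {G g : ℝ → ℝ} (hG : IsPotential G α) (hg : IsPseudoInverse g G)
    {H : Eu d → Eu d → ℝ} (hH : IsHamiltonian Ω H β)
    {j : Eu d → ℝ} (hj : IsInflow Ω ΓN j β)
    {ψ : Eu d → ℝ} {Dψ : Eu d → Eu d} {tψ : Eu d → ℝ}
    (hψ : MemSobolev Ω (α * β) ψ Dψ) (htψ : HasTrace Ω (α * β) ψ Dψ tψ)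
    {m u : Eu d → ℝ} {Du : Eu d → Eu d} {tu : Eu d → ℝ}
    (hu : IsWeakSolution Ω ΓD ΓN α β H g j ψ Dψ tψ m u Du tu)
    {η ξ : Eu d → ℝ} {Dξ : Eu d → Eu d} {tξ : Eu d → ℝ}
    (hξ : IsWeakSolution Ω ΓD ΓN α β H g j ψ Dψ tψ η ξ Dξ tξ) :
    -- (1) the cross contact-set conditions on `Γ_D`, in the sense of normal traces,
    (FluxProductVanishes Ω ΓN j (flow H η Dξ)
        (fun x => ψ x - u x) (fun x => Dψ x - Du x) (fun x => tψ x - tu x) ∧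
      FluxProductVanishes Ω ΓN j (flow H m Du)
        (fun x => ψ x - ξ x) (fun x => Dψ x - Dξ x) (fun x => tψ x - tξ x)) ∧
    -- and pointwise almost everywhere where the normal traces are functions,
    ((∀ h : Eu d → ℝ, FluxIsFunction Ω ΓD ΓN j (flow H η Dξ) h →
        ∀ᵐ x ∂(surf Ω).restrict ΓD, (tψ x - tu x) * h x = 0) ∧
      (∀ h : Eu d → ℝ, FluxIsFunction Ω ΓD ΓN j (flow H m Du) h →
        ∀ᵐ x ∂(surf Ω).restrict ΓD, (tψ x - tξ x) * h x = 0)) ∧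
    -- (2) `η = m` almost everywhere in `Ω`,
    (∀ᵐ x ∂volume.restrict Ω, η x = m x) ∧
    -- (3) `Du = Dξ` almost everywhere in `{m > 0}`.
    (∀ᵐ x ∂volume.restrict Ω, 0 < m x → Du x = Dξ x) := by
  have hβ := hH.one_lt
  have := hΩ.isFiniteMeasure_surf hd
  exact theorem2_general hΩ.isOpen hΩ.isBounded hΓ.open_D hG.one_lt hβ
    (hg.strictMonoOn hG.convex (hG.c1.differentiable one_ne_zero))
    (fun _ => hH.differentiable hΩ.isOpen) hH.convex hH.exists_norm_gradient_le
    (hj.memLp_conjExponent hβ (le_mul_of_one_le_left (zero_le_one.trans hβ.le) hG.one_lt.le))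
    hψ htψ hu hξ
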